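/- Let \(X\) be a finite set and \(k \ge 1\) an integer. A family \(\mathcal{G} \subset \mathcal{P}X\) is called a \(k\)-generator for \(X\) if every subset of \(X\) can be expressed as a union of at most \(k\) pairwise disjoint sets in \(\mathcal{G}\). A family is called canonical (of the form \(\mathcal{F}_{n,k}\), where \(n=|X|\)) if it equals \(\bigcup_{i=1}^{k}\mathcal{P}(V_i)\setminus\{\emptyset\}\) for some partition \((V_i)_{i=1}^{k}\) of \(X\) into \(k\) nonempty classes of sizes as equal as possible. For every integer \(k\ge 1\) there is an \(n_0 = n_0(k)\) such that the following holds for every multiple \(n \ge n_0\) of \(k\) and every \(n\)-element set \(X\). Canonical families for \(X\) exist, and each of them is a \(k\)-generator for \(X\) with exactly \(k\,2^{n/k}-k\) members; write \(|\mathcal{F}_{n,k}| = k\,2^{n/k}-k\) for this common size. If \(\mathcal{G}\) is any \(k\)-generator for \(X\), then \(|\mathcal{G}|\ge|\mathcal{F}_{n,k}|\), and equality \(|\mathcal{G}|=|\mathcal{F}_{n,k}|\) holds only if \(\mathcal{G}\) is canonical. -/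

import Mathlib

/-- `G` is a `k`-generator for the finite set `X`: every subset `x` of `X` is a union of at most
`k` (pairwise) disjoint sets belonging to `G`. -/
def IsKGenerator {X : Type*} [DecidableEq X] (k : ℕ) (G : Finset (Finset X)) : Prop :=
  ∀ x : Finset X, ∃ S : Finset (Finset X), S ⊆ G ∧ S.card ≤ k ∧
    (∀ a ∈ S, ∀ b ∈ S, a ≠ b → Disjoint a b) ∧ S.biUnion id = x

/-- The family of all nonempty sets contained in some class of the partition `P` of `X`,
that is, the union of the power sets of the classes, without the empty set. -/
def powersetFamily {X : Type*} [Fintype X] [DecidableEq X]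
    (P : Finpartition (Finset.univ : Finset X)) : Finset (Finset X) :=
  (P.parts.biUnion Finset.powerset) \ {∅}

/-- `F` is of the form `F_{n,k}`: it is the power set family of a partition of `X` into `k`
classes whose sizes are as equal as possible. -/
def IsCanonical {X : Type*} [Fintype X] [DecidableEq X] (k : ℕ) (F : Finset (Finset X)) : Prop :=
  ∃ P : Finpartition (Finset.univ : Finset X),
    P.IsEquipartition ∧ P.parts.card = k ∧ F = powersetFamily P

/-!
The disjointness graph of a family has the members of the family as vertices, two members being
joined when they are disjoint. Let `n = k * N`, let `q = 2 ^ N`, and let `G` be a `k`-generator with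
at most `k * q - k` members, none of them empty. Representing the `2 ^ n = q ^ k` subsets of `X`
takes nearly `k! * q ^ k` ordered `k`-cliques in the disjointness graph of `G ∪ {∅}`, which is about
as many as a graph on `k * q` vertices without `(k + 1)`-cliques can have
(`factorial_mul_le_card_cliques`).

The `(k + 1)`-cliques are exponentially rare (`card_cliques_disjoint_le`): replacing the entries of
a random `(k + 1)`-tuple by unions of `(k + 1) ^ 2` independent members lowers the probability of
disjointness no further than to a fixed power of it, by Jensen's inequality, while such unions
nearly always have more than `n / (k + 1)` elements. The Moon–Moser inequality `moon_moser` then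
gives a stability statement whose error terms are polynomial in the density of `(k + 1)`-cliques:
the vertices can be coloured with `k` colours so that few pairs of one colour are joined
(`exists_coloring_of_card_cliques`), and nearly all pairs of members of different colours are
disjoint (`card_unrelated_le`).

No element of `X` then lies in a substantial proportion of the members of two colours. The
elements lying in a substantial proportion of the members of the colour `i` form a class `W i`. As
powers of two with a given product and nearly the least possible sum are equal, the classes
partition `X` into sets of size `N`, and `G` contains all but a small proportion of the subsets of
each class (`exists_partition_of_families`).

Finally, `G` is exactly the family of nonempty subsets of the classes (`mem_iff_of_few_missing`).
There are at most as many members of `G` meeting several classes as there are missing subsets of the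
classes. If `y` is a missing subset of `W i`, nearly every `x` with `x ∩ W i = y` has to contain a
member `e` meeting several classes with `e ∩ W i = y`. A bounded number of such members leaves a
positive proportion of these `x` uncovered, so each typical `y` requires more of them than the
total number allows.
-/

/-! ### Ordered cliques of a symmetric relation -/

/-- The ordered `j`-cliques of the relation `r`: the `j`-tuples any two entries of which are
related. An element related to itself may be repeated. -/
noncomputable def cliques {V : Type*} [Fintype V] (r : V → V → Prop) (j : ℕ) :
    Finset (Fin j → V) := by
  classical exact Finset.univ.filter fun v => ∀ a b, a ≠ b → r (v a) (v b)

/-- The elements related to every entry of the tuple `T`. -/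
noncomputable def commonNbrs {V : Type*} [Fintype V] (r : V → V → Prop) {j : ℕ} (T : Fin j → V) :
    Finset V := by
  classical exact Finset.univ.filter fun w => ∀ a, r w (T a)

/-- The ordered pairs of related elements of `s`. -/
noncomputable def edgesIn {V : Type*} (r : V → V → Prop) (s : Finset V) :
    Finset (V × V) := by
  classical exact (s ×ˢ s).filter fun p => r p.1 p.2

/-- The ordered pairs of related elements to which `c` gives the same colour. -/
noncomputable def monoEdges {V κ : Type*} [Fintype V] (r : V → V → Prop) (c : V → κ) :
    Finset (V × V) := by
  classical exact Finset.univ.filter fun p => r p.1 p.2 ∧ c p.1 = c p.2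

section Cliques

variable {V : Type*} [Fintype V] {r : V → V → Prop}

lemma mem_cliques {j : ℕ} {v : Fin j → V} :
    v ∈ cliques r j ↔ ∀ a b, a ≠ b → r (v a) (v b) := by
  simp [cliques]

lemma mem_commonNbrs {j : ℕ} {T : Fin j → V} {w : V} :
    w ∈ commonNbrs r T ↔ ∀ a, r w (T a) := by
  simp [commonNbrs]

lemma mem_edgesIn {V : Type*} {r : V → V → Prop} {s : Finset V} {p : V × V} :
    p ∈ edgesIn r s ↔ (p.1 ∈ s ∧ p.2 ∈ s) ∧ r p.1 p.2 := by
  simp [edgesIn]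

lemma mem_monoEdges {κ : Type*} {c : V → κ} {p : V × V} :
    p ∈ monoEdges r c ↔ r p.1 p.2 ∧ c p.1 = c p.2 := by
  simp [monoEdges]

lemma insertNth_mem_cliques (hr : ∀ a b, r a b → r b a) {j : ℕ} (i : Fin (j + 1)) (w : V)
    (S : Fin j → V) :
    (i.insertNth w S : Fin (j + 1) → V) ∈ cliques r (j + 1) ↔
      S ∈ cliques r j ∧ w ∈ commonNbrs r S := by
  rw [mem_cliques, mem_cliques, mem_commonNbrs]
  constructor
  · intro h
    refine ⟨fun a b hab => ?_, fun a => ?_⟩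
    · simpa using h (i.succAbove a) (i.succAbove b) (by simpa using hab)
    · simpa using h i (i.succAbove a) (Fin.succAbove_ne i a).symm
  · rintro ⟨h1, h2⟩ a b hab
    rcases Fin.eq_self_or_eq_succAbove i a with ha | ⟨a, rfl⟩ <;>
    rcases Fin.eq_self_or_eq_succAbove i b with hb | ⟨b, rfl⟩
    · exact absurd (ha.trans hb.symm) hab
    · simpa [ha] using h2 b
    · simpa [hb] using hr _ _ (h2 a)
    · simpa using h1 a b (by simpa using hab)

/-- Summation over the `(j + 1)`-cliques by the clique left after removing the entry `i`. -/
lemma sum_cliques_succ (hr : ∀ a b, r a b → r b a) {j : ℕ} (i : Fin (j + 1))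
    (f : (Fin (j + 1) → V) → ℝ) :
    ∑ T ∈ cliques r (j + 1), f T =
      ∑ S ∈ cliques r j, ∑ w ∈ commonNbrs r S, f (i.insertNth w S) := by
  rw [Finset.sum_sigma']
  refine Finset.sum_bij' (fun T _ => ⟨i.removeNth T, T i⟩)
    (fun p _ => i.insertNth p.2 p.1) ?_ ?_ ?_ ?_ ?_
  · intro T hT
    rw [Finset.mem_sigma]
    rw [← Fin.insertNth_self_removeNth i T, insertNth_mem_cliques hr] at hT
    exact hT
  · intro p hp
    rw [Finset.mem_sigma] at hp
    exact (insertNth_mem_cliques hr i p.2 p.1).2 hp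
  · intro T _
    exact Fin.insertNth_self_removeNth i T
  · intro p _
    simp
  · intro T _
    simp

lemma card_cliques_zero : (cliques r 0).card = 1 := by
  have : cliques r 0 = Finset.univ := by
    exact Finset.eq_univ_of_forall fun v => mem_cliques.2 fun a => a.elim0
  rw [this]
  simp

lemma card_cliques_succ (hr : ∀ a b, r a b → r b a) (j : ℕ) :
    ((cliques r (j + 1)).card : ℝ) = ∑ S ∈ cliques r j, ((commonNbrs r S).card : ℝ) := by
  have := sum_cliques_succ hr (0 : Fin (j + 1)) (fun _ => 1)
  simpa using this

lemma sum_commonNbrs_removeNth (hr : ∀ a b, r a b → r b a) {j : ℕ} (i : Fin (j + 1)) :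
    ∑ T ∈ cliques r (j + 1), ((commonNbrs r (i.removeNth T)).card : ℝ) =
      ∑ S ∈ cliques r j, ((commonNbrs r S).card : ℝ) ^ 2 := by
  rw [sum_cliques_succ hr i]
  simp [sq]

lemma card_cliques_add_two (hr : ∀ a b, r a b → r b a) (j : ℕ) :
    ((cliques r (j + 2)).card : ℝ) =
      ∑ S ∈ cliques r j, ((edgesIn r (commonNbrs r S)).card : ℝ) := by
  classical
  rw [card_cliques_succ hr, sum_cliques_succ hr (0 : Fin (j + 1))]
  refine Finset.sum_congr rfl fun S _ => ?_
  rw [← Nat.cast_sum, ← Finset.card_sigma]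
  congr 1
  refine Finset.card_bij' (fun p _ => (p.1, p.2)) (fun p _ => ⟨p.1, p.2⟩) ?_ ?_ ?_ ?_
  · rintro ⟨a, b⟩ h
    simp only [Finset.mem_sigma, mem_commonNbrs, mem_edgesIn, Fin.forall_fin_succ,
      Fin.insertNth_zero', Fin.cons_zero, Fin.cons_succ] at h ⊢
    exact ⟨⟨h.1, h.2.2⟩, hr _ _ h.2.1⟩
  · rintro ⟨a, b⟩ h
    simp only [Finset.mem_sigma, mem_commonNbrs, mem_edgesIn, Fin.forall_fin_succ,
      Fin.insertNth_zero', Fin.cons_zero, Fin.cons_succ] at h ⊢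
    exact ⟨h.1.1, hr _ _ h.2, h.1.2⟩
  · intros; rfl
  · intros; rfl

/-- The related pairs of common neighbours of `j`-tuples are the `(j + 2)`-cliques. -/
lemma sum_edgesIn_removeNth_le (hr : ∀ a b, r a b → r b a) {j : ℕ} (i : Fin (j + 1)) :
    ∑ T ∈ cliques r (j + 1), ((edgesIn r (commonNbrs r (i.removeNth T))).card : ℝ) ≤
      Fintype.card V * (cliques r (j + 2)).card := by
  rw [sum_cliques_succ hr i, card_cliques_add_two hr, Finset.mul_sum]
  refine Finset.sum_le_sum fun S _ => ?_
  simp only [Fin.removeNth_insertNth, Finset.sum_const, nsmul_eq_mul]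
  gcongr
  exact Finset.card_le_univ _

/-- An element related to all entries of `T` but the `i`-th, for two values of `i`, is related to
all entries of `T`. -/
lemma sum_card_commonNbrs_removeNth_le [DecidableEq V] {j : ℕ} (T : Fin (j + 1) → V) :
    ∑ i : Fin (j + 1), ((commonNbrs r (i.removeNth T)).card : ℝ) ≤
      (Finset.univ.biUnion fun i : Fin (j + 1) => commonNbrs r (i.removeNth T)).card
        + j * (commonNbrs r T).card := by
  classical
  have hmem : ∀ (i : Fin (j + 1)) (w : V),
      w ∈ commonNbrs r (i.removeNth T) ↔ ∀ a, a ≠ i → r w (T a) := by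
    intro i w
    rw [mem_commonNbrs]
    constructor
    · intro h a ha
      obtain ⟨b, rfl⟩ := Fin.exists_succAbove_eq ha
      exact h b
    · intro h a
      exact h _ (Fin.succAbove_ne i a)
  have hcard : ∀ s : Finset V, (s.card : ℝ) = ∑ w, if w ∈ s then (1 : ℝ) else 0 := by
    intro s
    simp
  simp_rw [hcard]
  rw [Finset.sum_comm, Finset.mul_sum, ← Finset.sum_add_distrib]
  refine Finset.sum_le_sum fun w _ => ?_
  by_cases hw : w ∈ commonNbrs r T
  · have h1 : ∀ i : Fin (j + 1), w ∈ commonNbrs r (i.removeNth T) := fun i =>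
      (hmem i w).2 fun a _ => mem_commonNbrs.1 hw a
    have h2 : w ∈ Finset.univ.biUnion fun i : Fin (j + 1) => commonNbrs r (i.removeNth T) := by
      simpa using ⟨0, h1 0⟩
    simp only [h1, h2, hw, if_true]
    simp
    linarith
  · by_cases h : ∃ i : Fin (j + 1), w ∈ commonNbrs r (i.removeNth T)
    · obtain ⟨i, hi⟩ := h
      have h2 : w ∈ Finset.univ.biUnion fun i : Fin (j + 1) => commonNbrs r (i.removeNth T) := by
        simpa using ⟨i, hi⟩
      have h3 : ∀ l : Fin (j + 1), l ≠ i → w ∉ commonNbrs r (l.removeNth T) := by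
        intro l hl hwl
        apply hw
        rw [mem_commonNbrs]
        intro a
        by_cases ha : a = i
        · exact (hmem l w).1 hwl a (by rw [ha]; exact hl.symm)
        · exact (hmem i w).1 hi a ha
      rw [Finset.sum_eq_single i (fun l _ hl => by simp [h3 l hl]) (by simp)]
      simp [hi, h2, hw]
    · push Not at h
      simp [h, hw]

/-- The Moon–Moser inequality for ordered cliques. -/
lemma moon_moser (hr : ∀ a b, r a b → r b a) (j : ℕ) :
    (j + 1) * ((cliques r (j + 1)).card : ℝ) ^ 2 ≤
      (cliques r j).card *
        (Fintype.card V * (cliques r (j + 1)).card + j * (cliques r (j + 2)).card) := by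
  classical
  have hcs : ((cliques r (j + 1)).card : ℝ) ^ 2 ≤
      (cliques r j).card * ∑ S ∈ cliques r j, ((commonNbrs r S).card : ℝ) ^ 2 := by
    rw [card_cliques_succ hr]
    exact sq_sum_le_card_mul_sum_sq
  have hsum : (j + 1) * ∑ S ∈ cliques r j, ((commonNbrs r S).card : ℝ) ^ 2 ≤
      Fintype.card V * (cliques r (j + 1)).card + j * (cliques r (j + 2)).card := by
    calc (j + 1) * ∑ S ∈ cliques r j, ((commonNbrs r S).card : ℝ) ^ 2
        = ∑ T ∈ cliques r (j + 1), ∑ i, ((commonNbrs r (Fin.removeNth i T)).card : ℝ) := by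
          rw [Finset.sum_comm]
          simp_rw [sum_commonNbrs_removeNth hr]
          simp
      _ ≤ ∑ T ∈ cliques r (j + 1), ((Fintype.card V : ℝ) + j * (commonNbrs r T).card) := by
          refine Finset.sum_le_sum fun T _ => (sum_card_commonNbrs_removeNth_le T).trans ?_
          gcongr
          exact Finset.card_le_univ _
      _ = _ := by
          rw [Finset.sum_add_distrib, ← Finset.mul_sum, ← card_cliques_succ hr (j + 1)]
          simp [mul_comm]
  calc (j + 1) * ((cliques r (j + 1)).card : ℝ) ^ 2
      ≤ (j + 1) * ((cliques r j).card *
          ∑ S ∈ cliques r j, ((commonNbrs r S).card : ℝ) ^ 2) := by gcongr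
    _ = (cliques r j).card * ((j + 1) *
          ∑ S ∈ cliques r j, ((commonNbrs r S).card : ℝ) ^ 2) := by ring
    _ ≤ _ := by gcongr

/-- If there are few `(k + 1)`-cliques in comparison with `k`-cliques, then the ratio of the numbers
of `(j + 1)`-cliques and `j`-cliques is not much larger than in a balanced complete `k`-partite
graph. -/
lemma card_cliques_succ_le (hr : ∀ a b, r a b → r b a) {k : ℕ} (hk : 1 ≤ k) {η : ℝ}
    (hη : 0 ≤ η)
    (h : ((cliques r (k + 1)).card : ℝ) ≤ η * Fintype.card V * (cliques r k).card)
    {j : ℕ} (hj : j ≤ k) :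
    ((cliques r (j + 1)).card : ℝ) ≤
      ((k - j : ℝ) / k + η) * Fintype.card V * (cliques r j).card := by
  have hk0 : (0 : ℝ) < k := by exact_mod_cast hk
  induction hj using Nat.decreasingInduction with
  | self => simpa using h
  | of_succ j hj ih =>
    have hjk : (j : ℝ) + 1 ≤ k := by exact_mod_cast hj
    have hmm := moon_moser hr j
    set a := ((cliques r j).card : ℝ)
    set b := ((cliques r (j + 1)).card : ℝ)
    set m := (Fintype.card V : ℝ)
    have ha : 0 ≤ a := Nat.cast_nonneg _
    have hm : 0 ≤ m := Nat.cast_nonneg _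
    rcases (Nat.cast_nonneg _ : (0 : ℝ) ≤ b).eq_or_lt with hb | hb
    · rw [show b = 0 from hb.symm]
      have : 0 ≤ (k - j : ℝ) / k := div_nonneg (by linarith) hk0.le
      positivity
    · have h1 : (j + 1) * b ^ 2 ≤
          a * (m * b + j * (((k - (j + 1 : ℕ) : ℝ) / k + η) * m * b)) :=
        hmm.trans (by gcongr)
      have h2 : (j + 1) * b ≤ a * (m + j * (((k - (j + 1 : ℕ) : ℝ) / k + η) * m)) := by
        refine le_of_mul_le_mul_right ?_ hb
        linarith
      have h3 : a * (m + j * (((k - (j + 1 : ℕ) : ℝ) / k + η) * m)) ≤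
          (j + 1) * (((k - j : ℝ) / k + η) * m * a) := by
        have e : (j + 1) * (((k - j : ℝ) / k + η) * m * a) -
            a * (m + j * (((k - (j + 1 : ℕ) : ℝ) / k + η) * m)) = η * (m * a) := by
          push_cast
          field_simp
          ring
        have : 0 ≤ η * (m * a) := by positivity
        linarith
      exact le_of_mul_le_mul_left (h2.trans h3) (by positivity)

/-- The product of the bounds for the ratios: up to a factor `(1 + k * η) ^ j` there are no more
`j`-cliques than in a balanced complete `k`-partite graph. -/
lemma card_cliques_le (hr : ∀ a b, r a b → r b a) {k : ℕ} (hk : 1 ≤ k) {η : ℝ}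
    (hη : 0 ≤ η)
    (h : ((cliques r (k + 1)).card : ℝ) ≤ η * Fintype.card V * (cliques r k).card)
    {j : ℕ} (hj : j ≤ k) :
    (k : ℝ) ^ j * (k - j).factorial * (cliques r j).card ≤
      k.factorial * ((1 + k * η) * Fintype.card V) ^ j := by
  have hk0 : (0 : ℝ) < k := by exact_mod_cast hk
  induction j with
  | zero => simp [card_cliques_zero]
  | succ j ih =>
    have ih := ih (by omega)
    have h1 := card_cliques_succ_le hr hk hη h (show j ≤ k by omega)
    have hjk : (j : ℝ) + 1 ≤ k := by exact_mod_cast hj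
    obtain ⟨d, rfl⟩ : ∃ d, k = j + 1 + d := ⟨k - (j + 1), by omega⟩
    rw [show j + 1 + d - j = d + 1 by omega, Nat.factorial_succ] at ih
    rw [show j + 1 + d - (j + 1) = d by omega]
    set K : ℝ := ((j + 1 + d : ℕ) : ℝ) with hK
    have hKd : K - j = d + 1 := by rw [hK]; push_cast; ring
    rw [hKd] at h1
    have hle : ((d + 1 : ℝ) / K + η) ≤ (d + 1) / K * (1 + K * η) := by
      have : (d + 1 : ℝ) / K * (1 + K * η) = (d + 1) / K + η + d * η := by field_simp; ring
      have : 0 ≤ d * η := by positivity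
      linarith
    calc K ^ (j + 1) * d.factorial * ((cliques r (j + 1)).card : ℝ)
        ≤ K ^ (j + 1) * d.factorial *
          ((d + 1) / K * (1 + K * η) * Fintype.card V * (cliques r j).card) := by
          gcongr
          exact h1.trans (by gcongr)
      _ = K ^ j * (((d + 1) * d.factorial : ℕ) : ℝ) * (cliques r j).card *
            ((1 + K * η) * Fintype.card V) := by
          push_cast
          field_simp
          ring
      _ ≤ _ := by
          rw [pow_succ _ j, ← mul_assoc (Nat.cast _)]
          exact mul_le_mul_of_nonneg_right ih (by positivity)

end Cliques

/-! ### Stability of the colouring -/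

lemma one_sub_mul_le_one_div_pow (K : ℕ) {y : ℝ} (hy : 0 ≤ y) :
    1 - (K : ℝ) * y ≤ 1 / (1 + y) ^ K := by
  rw [le_div_iff₀ (by positivity)]
  rcases le_or_gt 1 ((K : ℝ) * y) with h | h
  · exact (mul_nonpos_of_nonpos_of_nonneg (by linarith) (by positivity)).trans zero_le_one
  · rcases Nat.eq_zero_or_pos K with rfl | hK
    · simp
    have hK1 : (1 : ℝ) ≤ K := by exact_mod_cast hK
    have hy1 : y ≤ 1 := by nlinarith
    have := one_add_mul_le_pow (show (-2 : ℝ) ≤ -y by linarith) K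
    calc (1 - K * y) * (1 + y) ^ K ≤ (1 - y) ^ K * (1 + y) ^ K := by
          gcongr
          convert this using 1 <;> ring
      _ = (1 - y ^ 2) ^ K := by rw [← mul_pow]; ring
      _ ≤ 1 := pow_le_one₀ (by nlinarith) (by nlinarith)

set_option maxHeartbeats 800000 in
/-- Averaging over the `(K + 1)`-cliques: if the number of cliques is close to the largest possible
and larger cliques are rare, then for some clique `T` nearly every element is related to all but one
of the entries of `T`, and few pairs of elements with the same exceptional entry are related. -/
lemma exists_clique_of_card_cliques {V : Type*} [Fintype V] [DecidableEq V] {r : V → V → Prop}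
    (hr : ∀ a b, r a b → r b a) (K : ℕ) {q η : ℝ} (hη : 0 ≤ η) (hη2 : η ≤ 1 / 2)
    (hq : 0 < q) (hm : (Fintype.card V : ℝ) ≤ (K + 1) * q)
    (h1 : (1 - η) * ((K + 1).factorial * q ^ (K + 1)) ≤ (cliques r (K + 1)).card)
    (h2 : ((cliques r (K + 2)).card : ℝ) ≤ η * Fintype.card V ^ (K + 2)) :
    ∃ T ∈ cliques r (K + 1),
      (Fintype.card V : ℝ) * (Fintype.card V -
        (Finset.univ.biUnion fun i : Fin (K + 1) => commonNbrs r (i.removeNth T)).card) +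
        ∑ i : Fin (K + 1), ((edgesIn r (commonNbrs r (i.removeNth T))).card : ℝ) ≤
      (1 + 2 * (K + 1) ^ (K + 3) * (K + 2)) * η * (Fintype.card V : ℝ) ^ 2 := by
  set m := (Fintype.card V : ℝ) with hmdef
  set A := ((cliques r (K + 1)).card : ℝ) with hA
  set B := ((cliques r K).card : ℝ) with hB
  have hm0 : 0 ≤ m := Nat.cast_nonneg _
  have hfac : (1 : ℝ) ≤ (K + 1).factorial := by
    exact_mod_cast Nat.one_le_iff_ne_zero.2 (by positivity)
  have hApos : 0 < A := lt_of_lt_of_le (mul_pos (by linarith) (by positivity)) h1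
  have hAq : q ^ (K + 1) ≤ 2 * A := by
    have : (1 : ℝ) / 2 * (1 * q ^ (K + 1)) ≤ A := le_trans
      (mul_le_mul (by linarith) (by gcongr) (by positivity) (by linarith)) h1
    linarith
  -- The relative number of larger cliques, for the counting of cliques of all sizes.
  set θ : ℝ := 2 * (K + 1) ^ (K + 1) * η with hθ
  have hθ0 : 0 ≤ θ := by positivity
  have h3 : ((cliques r (K + 2)).card : ℝ) ≤ θ * m * A := by
    calc ((cliques r (K + 2)).card : ℝ) ≤ η * m ^ (K + 2) := h2
      _ = η * m * m ^ (K + 1) := by ring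
      _ ≤ η * m * (((K + 1) * q) ^ (K + 1)) := by gcongr
      _ = η * m * (K + 1) ^ (K + 1) * q ^ (K + 1) := by rw [mul_pow]; ring
      _ ≤ η * m * (K + 1) ^ (K + 1) * (2 * A) := by gcongr
      _ = θ * m * A := by rw [hθ]; ring
  have h4 := card_cliques_le hr (show 1 ≤ K + 1 by omega) hθ0 h3 (show K ≤ K + 1 by omega)
  rw [show K + 1 - K = 1 by omega] at h4
  push_cast [Nat.factorial_one] at h4
  rw [mul_one, ← hB, ← hmdef] at h4
  -- The ratio of `(K + 1)`-cliques and `K`-cliques is nearly as large as possible.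
  have hBern : 1 - (K : ℝ) * ((K + 1) * θ) ≤ 1 / (1 + (K + 1) * θ) ^ K :=
    one_sub_mul_le_one_div_pow K (by positivity)
  have hratio : (1 - η) * (1 - K * ((K + 1) * θ)) * (m * B) ≤ (K + 1) * A := by
    have hpos : 0 < (1 + (K + 1) * θ) ^ K := by positivity
    have e1 : (1 - η) * (m * B) ≤ (1 + (K + 1) * θ) ^ K * ((K + 1) * A) := by
      have hk : (0 : ℝ) < (K + 1) ^ K := by positivity
      refine le_of_mul_le_mul_left ?_ hk
      calc (K + 1 : ℝ) ^ K * ((1 - η) * (m * B))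
          = (1 - η) * m * ((K + 1) ^ K * B) := by ring
        _ ≤ (1 - η) * m * ((K + 1).factorial * ((1 + (K + 1) * θ) * m) ^ K) := by
            have : 0 ≤ (1 - η) * m := mul_nonneg (by linarith only [hη2]) hm0
            gcongr
        _ = (1 + (K + 1) * θ) ^ K * ((1 - η) * ((K + 1).factorial * m ^ (K + 1))) := by
            rw [mul_pow]; ring
        _ ≤ (1 + (K + 1) * θ) ^ K * ((1 - η) * ((K + 1).factorial * ((K + 1) * q) ^ (K + 1))) := by
            have : 0 ≤ 1 - η := by linarith
            gcongr
        _ = (1 + (K + 1) * θ) ^ K * (K + 1) ^ (K + 1) *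
              ((1 - η) * ((K + 1).factorial * q ^ (K + 1))) := by rw [mul_pow]; ring
        _ ≤ (1 + (K + 1) * θ) ^ K * (K + 1) ^ (K + 1) * A := by gcongr
        _ = _ := by ring
    have hB0 : 0 ≤ B := Nat.cast_nonneg _
    calc (1 - η) * (1 - K * ((K + 1) * θ)) * (m * B)
        = (1 - K * ((K + 1) * θ)) * ((1 - η) * (m * B)) := by ring
      _ ≤ 1 / (1 + (K + 1) * θ) ^ K * ((1 - η) * (m * B)) := by
          have : 0 ≤ 1 - η := by linarith
          gcongr
      _ ≤ 1 / (1 + (K + 1) * θ) ^ K * ((1 + (K + 1) * θ) ^ K * ((K + 1) * A)) := by gcongr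
      _ = (K + 1) * A := by field_simp
  set ρ := (1 - η) * (1 - K * ((K + 1) * θ)) with hρ
  have hρle : 1 - η - K * (K + 1) * θ ≤ ρ := by
    have : 0 ≤ η * (K * ((K + 1) * θ)) := by positivity
    rw [hρ]
    linarith
  -- The sum of squares of degrees of `K`-cliques.
  set D := ∑ S ∈ cliques r K, ((commonNbrs r S).card : ℝ) ^ 2 with hD
  have hcs : A ^ 2 ≤ B * D := by
    rw [hA, card_cliques_succ hr]
    exact sq_sum_le_card_mul_sum_sq
  have hD1 : ρ * m * A ≤ (K + 1) * D := by
    have hB1 : 0 < B := by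
      rcases (Nat.cast_nonneg _ : (0 : ℝ) ≤ B).eq_or_lt with h | h
      · rw [show B = 0 from h.symm, zero_mul] at hcs
        exact absurd hcs (not_le.2 (by positivity))
      · exact h
    refine le_of_mul_le_mul_left ?_ hB1
    calc B * (ρ * m * A) = (ρ * (m * B)) * A := by ring
      _ ≤ ((K + 1) * A) * A := by gcongr
      _ = (K + 1) * A ^ 2 := by ring
      _ ≤ (K + 1) * (B * D) := by gcongr
      _ = _ := by ring
  have hsumD : ∑ T ∈ cliques r (K + 1), ∑ i : Fin (K + 1),
      ((commonNbrs r (i.removeNth T)).card : ℝ) = (K + 1) * D := by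
    rw [Finset.sum_comm]
    simp_rw [sum_commonNbrs_removeNth hr]
    simp [hD]
  have hsumE : ∑ T ∈ cliques r (K + 1), ∑ i : Fin (K + 1),
      ((edgesIn r (commonNbrs r (i.removeNth T))).card : ℝ) ≤
      (K + 1) * (m * (θ * m * A)) := by
    rw [Finset.sum_comm]
    calc _ ≤ ∑ i : Fin (K + 1), m * ((cliques r (K + 2)).card : ℝ) :=
          Finset.sum_le_sum fun i _ => sum_edgesIn_removeNth_le hr i
      _ = (K + 1) * (m * ((cliques r (K + 2)).card : ℝ)) := by simp
      _ ≤ _ := by gcongr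
  have hne : (cliques r (K + 1)).Nonempty := by
    rw [← Finset.card_pos]
    exact Nat.cast_pos.1 hApos
  refine Finset.exists_le_of_sum_le hne ?_
  rw [Finset.sum_add_distrib, Finset.sum_const, nsmul_eq_mul, ← Finset.mul_sum, ← hA]
  have hunc : ∑ T ∈ cliques r (K + 1), (m -
        ((Finset.univ.biUnion fun i : Fin (K + 1) => commonNbrs r (i.removeNth T)).card : ℝ)) ≤
      m * A + K * (θ * m * A) - (K + 1) * D := by
    calc _ ≤ ∑ T ∈ cliques r (K + 1), (m + K * ((commonNbrs r T).card : ℝ) -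
          ∑ i : Fin (K + 1), ((commonNbrs r (i.removeNth T)).card : ℝ)) := by
          refine Finset.sum_le_sum fun T _ => ?_
          have := sum_card_commonNbrs_removeNth_le (r := r) T
          linarith
      _ = m * A + K * ((cliques r (K + 2)).card : ℝ) - (K + 1) * D := by
          rw [Finset.sum_sub_distrib, hsumD, Finset.sum_add_distrib, ← Finset.mul_sum,
            ← card_cliques_succ hr (K + 1), Finset.sum_const, nsmul_eq_mul, ← hA]
          ring
      _ ≤ _ := by gcongr
  have hfin : m * A + K * (θ * m * A) - (K + 1) * D ≤ (η + K * (K + 2) * θ) * (m * A) := by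
    have : (1 - η - K * (K + 1) * θ) * (m * A) ≤ ρ * (m * A) := by gcongr
    linarith
  calc _ ≤ m * ((η + K * (K + 2) * θ) * (m * A)) + (K + 1) * (m * (θ * m * A)) :=
        add_le_add (mul_le_mul_of_nonneg_left (hunc.trans hfin) hm0) hsumE
    _ = (η + (K * (K + 2) + (K + 1)) * θ) * (m ^ 2 * A) := by ring
    _ ≤ (η + (K + 1) ^ 2 * (K + 2) * θ) * (m ^ 2 * A) := by
        gcongr
        have : (0 : ℝ) ≤ K := Nat.cast_nonneg _
        nlinarith [mul_nonneg this this, mul_nonneg (mul_nonneg this this) this]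
    _ = _ := by rw [hθ]; ring

/-- If nearly the largest possible number of `(K + 1)`-tuples are cliques and few `(K + 2)`-tuples
are, then the elements can be coloured with `K + 1` colours so that few pairs of elements of the
same colour are related. -/
lemma exists_coloring_of_card_cliques {V : Type*} [Fintype V] {r : V → V → Prop}
    (hr : ∀ a b, r a b → r b a) (K : ℕ) {q η : ℝ} (hη : 0 ≤ η) (hη2 : η ≤ 1 / 2)
    (hq : 0 < q) (hm : (Fintype.card V : ℝ) ≤ (K + 1) * q)
    (h1 : (1 - η) * ((K + 1).factorial * q ^ (K + 1)) ≤ (cliques r (K + 1)).card)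
    (h2 : ((cliques r (K + 2)).card : ℝ) ≤ η * Fintype.card V ^ (K + 2)) :
    ∃ c : V → Fin (K + 1), ((monoEdges r c).card : ℝ) ≤
      2 * (1 + 2 * (K + 1) ^ (K + 3) * (K + 2)) * η * (Fintype.card V : ℝ) ^ 2 := by
  classical
  obtain ⟨T, -, hT⟩ := exists_clique_of_card_cliques hr K hη hη2 hq hm h1 h2
  set U := Finset.univ.biUnion fun i : Fin (K + 1) => commonNbrs r (i.removeNth T) with hU
  have hc : ∀ w, ∃ i : Fin (K + 1), w ∈ U → w ∈ commonNbrs r (i.removeNth T) := by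
    intro w
    by_cases hw : w ∈ U
    · obtain ⟨i, -, hi⟩ := Finset.mem_biUnion.1 hw
      exact ⟨i, fun _ => hi⟩
    · exact ⟨0, fun h => absurd h hw⟩
  choose c hc using hc
  refine ⟨c, ?_⟩
  have hsub : monoEdges r c ⊆ (Finset.univ.biUnion fun i : Fin (K + 1) =>
      edgesIn r (commonNbrs r (i.removeNth T))) ∪ (Uᶜ ×ˢ Finset.univ ∪ Finset.univ ×ˢ Uᶜ) := by
    intro p hp
    obtain ⟨hp1, hp2⟩ := mem_monoEdges.1 hp
    by_cases ha : p.1 ∈ U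
    · by_cases hb : p.2 ∈ U
      · refine Finset.mem_union_left _ (Finset.mem_biUnion.2 ⟨c p.1, Finset.mem_univ _, ?_⟩)
        exact mem_edgesIn.2 ⟨⟨hc _ ha, hp2 ▸ hc _ hb⟩, hp1⟩
      · exact Finset.mem_union_right _ (Finset.mem_union_right _
          (Finset.mem_product.2 ⟨Finset.mem_univ _, Finset.mem_compl.2 hb⟩))
    · exact Finset.mem_union_right _ (Finset.mem_union_left _
        (Finset.mem_product.2 ⟨Finset.mem_compl.2 ha, Finset.mem_univ _⟩))
  have hcard : ((monoEdges r c).card : ℝ) ≤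
      ∑ i : Fin (K + 1), ((edgesIn r (commonNbrs r (i.removeNth T))).card : ℝ) +
        2 * (Fintype.card V * (Fintype.card V - U.card)) := by
    have hUc : ((Uᶜ).card : ℝ) = Fintype.card V - U.card := by
      rw [Finset.card_compl, Nat.cast_sub (Finset.card_le_univ _)]
    have h3 : (monoEdges r c).card ≤
        ∑ i : Fin (K + 1), (edgesIn r (commonNbrs r (i.removeNth T))).card +
          ((Uᶜ).card * Fintype.card V + Fintype.card V * (Uᶜ).card) := by
      refine (Finset.card_le_card hsub).trans ((Finset.card_union_le _ _).trans ?_)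
      refine add_le_add Finset.card_biUnion_le ((Finset.card_union_le _ _).trans_eq ?_)
      rw [Finset.card_product, Finset.card_product, Finset.card_univ]
    have h4 : ((monoEdges r c).card : ℝ) ≤
        ∑ i : Fin (K + 1), ((edgesIn r (commonNbrs r (i.removeNth T))).card : ℝ) +
          (((Uᶜ).card : ℝ) * Fintype.card V + Fintype.card V * (Uᶜ).card) := by
      exact_mod_cast h3
    rw [hUc] at h4
    linarith
  have hE : 0 ≤ ∑ i : Fin (K + 1), ((edgesIn r (commonNbrs r (i.removeNth T))).card : ℝ) :=
    Finset.sum_nonneg fun _ _ => Nat.cast_nonneg _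
  generalize ∑ i : Fin (K + 1), ((edgesIn r (commonNbrs r (i.removeNth T))).card : ℝ) = e at *
  linarith

/-! ### Transversal cliques of a colouring -/

/-- The ordered cliques whose `i`-th entry has colour `i`. -/
noncomputable def transversalCliques {V : Type*} [Fintype V] (r : V → V → Prop) {k : ℕ}
    (c : V → Fin k) : Finset (Fin k → V) :=
  (cliques r k).filter fun v => ∀ i, c (v i) = i

/-- Prescribing two entries of a tuple in a product of finite sets by a relation: a double count
by exchanging the two entries with a further pair. -/
lemma card_filter_piFinset_mul {ι V : Type*} [Fintype ι] [DecidableEq ι] (s : ι → Finset V)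
    {a b : ι} (hab : a ≠ b) (P : V → V → Prop) [DecidableRel P] :
    ((Fintype.piFinset s).filter fun v => P (v a) (v b)).card * ((s a).card * (s b).card) =
      ((s a ×ˢ s b).filter fun p => P p.1 p.2).card * ∏ i, (s i).card := by
  rw [← Fintype.card_piFinset, ← Finset.card_product, ← Finset.card_product,
    ← Finset.card_product]
  refine Finset.card_nbij'
    (fun x => ((x.1 a, x.1 b), Function.update (Function.update x.1 a x.2.1) b x.2.2))
    (fun x => (Function.update (Function.update x.2 a x.1.1) b x.1.2, (x.2 a, x.2 b)))
    ?_ ?_ ?_ ?_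
  · rintro ⟨v, x, y⟩ h
    simp only [Finset.coe_product, Set.mem_prod, Finset.mem_coe, Finset.mem_filter,
      Fintype.mem_piFinset, Finset.mem_product] at h ⊢
    refine ⟨⟨⟨h.1.1 a, h.1.1 b⟩, h.1.2⟩, fun i => ?_⟩
    by_cases hb : i = b
    · subst hb; simpa using h.2.2
    · by_cases ha : i = a
      · subst ha; simpa [hb] using h.2.1
      · simpa [ha, hb] using h.1.1 i
  · rintro ⟨⟨x, y⟩, v⟩ h
    simp only [Finset.coe_product, Set.mem_prod, Finset.mem_coe, Finset.mem_filter,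
      Fintype.mem_piFinset, Finset.mem_product] at h ⊢
    refine ⟨⟨fun i => ?_, ?_⟩, h.2 a, h.2 b⟩
    · by_cases hb : i = b
      · subst hb; simpa using h.1.1.2
      · by_cases ha : i = a
        · subst ha; simpa [hb] using h.1.1.1
        · simpa [ha, hb] using h.2 i
    · simpa [hab] using h.1.2
  · rintro ⟨v, x, y⟩ _
    refine Prod.ext (funext fun i => ?_) (by simp [hab])
    by_cases hb : i = b
    · subst hb; simp
    · by_cases ha : i = a
      · subst ha; simp [hb]
      · simp [ha, hb]
  · rintro ⟨⟨x, y⟩, v⟩ _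
    refine Prod.ext (by simp [hab]) (funext fun i => ?_)
    by_cases hb : i = b
    · subst hb; simp
    · by_cases ha : i = a
      · subst ha; simp [hb]
      · simp [ha, hb]

/-- The cliques with entries of distinct colours arise from the transversal cliques by permuting
the entries. -/
lemma card_filter_injective_le {V : Type*} [Fintype V] {r : V → V → Prop} {k : ℕ}
    (c : V → Fin k) [DecidablePred fun v : Fin k → V => Function.Injective (c ∘ v)] :
    ((cliques r k).filter fun v => Function.Injective (c ∘ v)).card ≤
      k.factorial * (transversalCliques r c).card := by
  classical
  have hperm : k.factorial = (Finset.univ : Finset (Equiv.Perm (Fin k))).card := by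
    rw [Finset.card_univ, Fintype.card_perm, Fintype.card_fin]
  rw [hperm, ← Finset.card_product]
  let σ : (Fin k → V) → Equiv.Perm (Fin k) := fun v =>
    if h : Function.Injective (c ∘ v) then
      Equiv.ofBijective (c ∘ v) (Finite.injective_iff_bijective.1 h) else 1
  have hσ : ∀ v, Function.Injective (c ∘ v) → ∀ i, σ v i = c (v i) := by
    intro v hv i
    simp [σ, hv]
  refine Finset.card_le_card_of_injOn (fun v => (σ v, v ∘ (σ v).symm)) ?_ ?_
  · intro v hv
    obtain ⟨h1, h2⟩ := Finset.mem_filter.1 hv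
    refine Finset.mem_product.2 ⟨Finset.mem_univ _, Finset.mem_filter.2 ⟨mem_cliques.2 ?_, ?_⟩⟩
    · intro a b hab
      exact mem_cliques.1 h1 _ _ (by simpa using hab)
    · intro i
      change c (v ((σ v).symm i)) = i
      rw [← hσ v h2, Equiv.apply_symm_apply]
  · intro v _ w _ hvw
    obtain ⟨h1, h2⟩ := Prod.mk.inj hvw
    rw [h1] at h2
    funext i
    simpa using congrFun h2 (σ w i)

/-- If few pairs of one colour are related, then few cliques have two entries of the same colour,
and so nearly the largest possible number of transversals are cliques. -/
lemma le_card_transversalCliques {V : Type*} [Fintype V] {r : V → V → Prop} {k : ℕ}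
    (c : V → Fin k) {q η δ : ℝ} (hδ : 0 ≤ δ) (hm : (Fintype.card V : ℝ) ≤ k * q)
    (hmono : ((monoEdges r c).card : ℝ) ≤ δ * (Fintype.card V : ℝ) ^ 2)
    (h1 : (1 - η) * (k.factorial * q ^ k) ≤ (cliques r k).card) (hq : 0 ≤ q) :
    (1 - η - k ^ (k + 2) * δ) * q ^ k ≤ (transversalCliques r c).card := by
  classical
  set m := (Fintype.card V : ℝ) with hmdef
  have hm0 : 0 ≤ m := Nat.cast_nonneg _
  -- The tuples with a prescribed pair of related entries of the same colour.
  let Q : Fin k × Fin k → Finset (Fin k → V) := fun p =>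
    Finset.univ.filter fun v => r (v p.1) (v p.2) ∧ c (v p.1) = c (v p.2)
  have hQ : ∀ p : Fin k × Fin k, p.1 ≠ p.2 → ((Q p).card : ℝ) ≤ δ * m ^ k := by
    intro p hp
    have h := card_filter_piFinset_mul (fun _ : Fin k => (Finset.univ : Finset V)) hp
      (fun x y => r x y ∧ c x = c y)
    rw [Fintype.piFinset_univ, Finset.univ_product_univ, Finset.prod_const, Finset.card_univ,
      Finset.card_univ, Fintype.card_fin] at h
    have h' : ((Q p).card : ℝ) * m ^ 2 = (monoEdges r c).card * m ^ k := by
      rw [sq, hmdef]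
      convert congrArg (Nat.cast : ℕ → ℝ) h using 1
      · push_cast; rfl
      · push_cast
        congr 3
        ext p
        simp [mem_monoEdges]
    rcases hm0.eq_or_lt with h0 | h0
    · have : IsEmpty V := by
        rw [← Fintype.card_eq_zero_iff]
        exact Nat.cast_eq_zero.1 h0.symm
      have : (Q p) = ∅ := Finset.eq_empty_of_forall_notMem fun v => this.elim (v p.1)
      rw [this]
      simpa using mul_nonneg hδ (pow_nonneg hm0 k)
    · refine le_of_mul_le_mul_right ?_ (pow_pos h0 2)
      calc ((Q p).card : ℝ) * m ^ 2 = (monoEdges r c).card * m ^ k := h'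
        _ ≤ δ * m ^ 2 * m ^ k := by gcongr
        _ = _ := by ring
  have hcover : cliques r k ⊆ ((cliques r k).filter fun v => Function.Injective (c ∘ v)) ∪
      (Finset.univ.filter fun p : Fin k × Fin k => p.1 ≠ p.2).biUnion Q := by
    intro v hv
    by_cases hinj : Function.Injective (c ∘ v)
    · exact Finset.mem_union_left _ (Finset.mem_filter.2 ⟨hv, hinj⟩)
    · refine Finset.mem_union_right _ ?_
      simp only [Function.Injective, not_forall] at hinj
      obtain ⟨a, b, hab, hne⟩ := hinj
      exact Finset.mem_biUnion.2 ⟨(a, b), by simpa using hne,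
        Finset.mem_filter.2 ⟨Finset.mem_univ _, mem_cliques.1 hv a b hne, hab⟩⟩
  have hQsum : (((Finset.univ.filter fun p : Fin k × Fin k => p.1 ≠ p.2).biUnion Q).card : ℝ) ≤
      k ^ (k + 2) * δ * q ^ k := by
    calc (((Finset.univ.filter fun p : Fin k × Fin k => p.1 ≠ p.2).biUnion Q).card : ℝ)
        ≤ ∑ p ∈ Finset.univ.filter fun p : Fin k × Fin k => p.1 ≠ p.2, ((Q p).card : ℝ) := by
          exact_mod_cast Finset.card_biUnion_le
      _ ≤ ∑ p ∈ Finset.univ.filter fun p : Fin k × Fin k => p.1 ≠ p.2, δ * m ^ k :=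
          Finset.sum_le_sum fun p hp => hQ p (Finset.mem_filter.1 hp).2
      _ ≤ ∑ p : Fin k × Fin k, δ * m ^ k :=
          Finset.sum_le_sum_of_subset_of_nonneg (Finset.filter_subset _ _)
            fun _ _ _ => by positivity
      _ = k ^ 2 * (δ * m ^ k) := by
          simp [sq]
      _ ≤ k ^ 2 * (δ * (k * q) ^ k) := by gcongr
      _ = _ := by rw [mul_pow]; ring
  have hN : ((cliques r k).card : ℝ) ≤
      k.factorial * (transversalCliques r c).card + k ^ (k + 2) * δ * q ^ k := by
    have h3 : (cliques r k).card ≤ k.factorial * (transversalCliques r c).card +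
        ((Finset.univ.filter fun p : Fin k × Fin k => p.1 ≠ p.2).biUnion Q).card :=
      (Finset.card_le_card hcover).trans ((Finset.card_union_le _ _).trans
        (add_le_add_left (card_filter_injective_le c) _))
    have h4 : ((cliques r k).card : ℝ) ≤ k.factorial * (transversalCliques r c).card +
        ((Finset.univ.filter fun p : Fin k × Fin k => p.1 ≠ p.2).biUnion Q).card := by
      exact_mod_cast h3
    linarith
  have hfac : (1 : ℝ) ≤ k.factorial := by
    exact_mod_cast Nat.one_le_iff_ne_zero.2 (by positivity)
  refine le_of_mul_le_mul_left ?_ (lt_of_lt_of_le one_pos hfac)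
  have h5 : k ^ (k + 2) * δ * q ^ k ≤ k.factorial * (k ^ (k + 2) * δ * q ^ k) :=
    le_mul_of_one_le_left (by positivity) hfac
  linarith

lemma prod_card_le_pow {k : ℕ} (f : Fin k → ℝ) (hf : ∀ i, 0 ≤ f i) {q : ℝ}
    (h : ∑ i, f i ≤ k * q) : ∏ i, f i ≤ q ^ k := by
  rcases Nat.eq_zero_or_pos k with rfl | hk
  · simp
  have hk0 : (0 : ℝ) < k := by exact_mod_cast hk
  have hagm := Real.geom_mean_le_arith_mean Finset.univ (fun _ => 1) f (fun _ _ => zero_le_one)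
    (by simpa using hk) (fun i _ => hf i)
  simp only [Real.rpow_one, Finset.sum_const, Finset.card_univ, Fintype.card_fin, nsmul_eq_mul,
    mul_one, one_mul] at hagm
  have hle : (∏ i, f i) ^ (k : ℝ)⁻¹ ≤ q := hagm.trans (by rw [div_le_iff₀ hk0]; linarith)
  have hp : 0 ≤ ∏ i, f i := Finset.prod_nonneg fun i _ => hf i
  calc ∏ i, f i = ((∏ i, f i) ^ (k : ℝ)⁻¹) ^ k := (Real.rpow_inv_natCast_pow hp hk.ne').symm
    _ ≤ q ^ k := by gcongr

/-- If nearly all transversals of nearly the largest possible number are cliques, then nearly all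
pairs of elements of two different colours are related. -/
lemma card_unrelated_le {V : Type*} [Fintype V] [DecidableEq V] {r : V → V → Prop}
    [DecidableRel r] {k : ℕ} (c : V → Fin k) {q ε : ℝ} (hq : 0 < q)
    (hε2 : ε ≤ 1 / 2) (hm : (Fintype.card V : ℝ) ≤ k * q)
    (h : (1 - ε) * q ^ k ≤ (transversalCliques r c).card) :
    (1 - ε) * q ^ k ≤ ∏ i, ((Finset.univ.filter fun v => c v = i).card : ℝ) ∧
    ∀ i j, i ≠ j →
      ((((Finset.univ.filter fun v => c v = i) ×ˢ (Finset.univ.filter fun v => c v = j)).filter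
        fun p => ¬ r p.1 p.2).card : ℝ) ≤
      2 * ε * ((Finset.univ.filter fun v => c v = i).card *
        (Finset.univ.filter fun v => c v = j).card) := by
  set s : Fin k → Finset V := fun i => Finset.univ.filter fun v => c v = i with hs
  have hsum : ∑ i, ((s i).card : ℝ) = Fintype.card V := by
    rw [← Finset.card_univ, Finset.card_eq_sum_card_fiberwise (f := c) (t := Finset.univ)
      (fun _ _ => Finset.mem_coe.2 (Finset.mem_univ _))]
    push_cast
    rfl
  have hle : ∏ i, ((s i).card : ℝ) ≤ q ^ k :=
    prod_card_le_pow _ (fun _ => Nat.cast_nonneg _) (hsum ▸ hm)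
  have hsub : transversalCliques r c ⊆ Fintype.piFinset s := by
    intro v hv
    rw [Fintype.mem_piFinset]
    intro i
    exact Finset.mem_filter.2 ⟨Finset.mem_univ _, (Finset.mem_filter.1 hv).2 i⟩
  have hprod : ((Fintype.piFinset s).card : ℝ) = ∏ i, ((s i).card : ℝ) := by
    rw [Fintype.card_piFinset]
    push_cast
    rfl
  have hge : (1 - ε) * q ^ k ≤ ∏ i, ((s i).card : ℝ) := by
    rw [← hprod]
    exact h.trans (by exact_mod_cast Finset.card_le_card hsub)
  refine ⟨hge, fun i j hij => ?_⟩
  have hswap := card_filter_piFinset_mul s hij (fun x y => ¬ r x y)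
  have hbad : (((Fintype.piFinset s).filter fun v => ¬ r (v i) (v j)).card : ℝ) +
      (transversalCliques r c).card ≤ ∏ i, ((s i).card : ℝ) := by
    rw [← hprod]
    norm_cast
    rw [← Finset.card_union_of_disjoint]
    · exact Finset.card_le_card (Finset.union_subset (Finset.filter_subset _ _) hsub)
    · rw [Finset.disjoint_left]
      intro v hv hv'
      exact (Finset.mem_filter.1 hv).2
        (mem_cliques.1 (Finset.mem_filter.1 hv').1 i j hij)
  have hswap' : (((Fintype.piFinset s).filter fun v => ¬ r (v i) (v j)).card : ℝ) *
      ((s i).card * (s j).card) =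
      ((s i ×ˢ s j).filter fun p => ¬ r p.1 p.2).card * ∏ i, ((s i).card : ℝ) := by
    exact_mod_cast hswap
  have hqk : 0 < q ^ k := by positivity
  have hpos : 0 < ∏ i, ((s i).card : ℝ) :=
    lt_of_lt_of_le (mul_pos (by linarith) hqk) hge
  refine le_of_mul_le_mul_right ?_ hpos
  rw [← hswap']
  calc (((Fintype.piFinset s).filter fun v => ¬ r (v i) (v j)).card : ℝ) *
        ((s i).card * (s j).card)
      ≤ (2 * ε * ∏ i, ((s i).card : ℝ)) * ((s i).card * (s j).card) := by
        gcongr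
        have : 0 ≤ (((Fintype.piFinset s).filter fun v => ¬ r (v i) (v j)).card : ℝ) :=
          Nat.cast_nonneg _
        have hε : 0 ≤ ε := by nlinarith
        nlinarith
    _ = _ := by ring

/-! ### From nearly disjoint families to a partition of the ground set -/

/-- By convexity of `2 ^ x`, integers with mean `N` whose powers of two add up to nearly the least
possible sum are all equal to `N`. -/
lemma eq_of_sum_two_pow_lt {k N : ℕ} (v : Fin k → ℕ) (hsum : ∑ i, v i = k * N)
    (h : ∑ i, (2 : ℝ) ^ v i < (k + 1 / 2) * 2 ^ N) (i : Fin k) : v i = N := by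
  have hq : (0 : ℝ) < 2 ^ N := by positivity
  have hterm : ∀ u : ℕ, (2 : ℝ) ^ N * (1 + ((u : ℝ) - N)) ≤ 2 ^ u := by
    intro u
    rcases le_total N u with hu | hu
    · obtain ⟨d, rfl⟩ := Nat.exists_eq_add_of_le hu
      have h1 := one_add_mul_le_pow (show (-2 : ℝ) ≤ 1 by norm_num) d
      norm_num at h1
      rw [pow_add]
      push_cast
      gcongr
      linarith
    · obtain ⟨d, rfl⟩ := Nat.exists_eq_add_of_le hu
      have hu0 : (0 : ℝ) < 2 ^ u := by positivity
      rw [pow_add]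
      push_cast
      have h2 : (2 : ℝ) ^ d * (1 - d) ≤ 1 := by
        rcases Nat.eq_zero_or_pos d with rfl | hd
        · simp
        · have : (1 : ℝ) ≤ d := by exact_mod_cast hd
          exact (mul_nonpos_of_nonneg_of_nonpos (by positivity) (by linarith)).trans zero_le_one
      nlinarith
  have hterm' : ∀ u : ℕ, u < N → (2 : ℝ) ^ N * (1 + ((u : ℝ) - N)) + 2 ^ N / 2 ≤ 2 ^ u := by
    intro u hu
    obtain ⟨d, rfl⟩ := Nat.exists_eq_add_of_lt hu
    have hu0 : (0 : ℝ) < 2 ^ u := by positivity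
    have h2 : (2 : ℝ) ^ (d + 1) * (3 / 2 - (d + 1)) ≤ 1 := by
      rcases Nat.eq_zero_or_pos d with rfl | hd
      · norm_num
      · have : (1 : ℝ) ≤ d := by exact_mod_cast hd
        exact (mul_nonpos_of_nonneg_of_nonpos (by positivity) (by linarith)).trans zero_le_one
    rw [add_assoc u, pow_add]
    push_cast
    nlinarith
  have hsumr : ∑ i, ((v i : ℝ) - N) = 0 := by
    rw [Finset.sum_sub_distrib]
    have : ((∑ i, v i : ℕ) : ℝ) = k * N := by exact_mod_cast hsum
    push_cast at this
    simp [this]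
  have hall : ∑ i, (2 : ℝ) ^ N * (1 + ((v i : ℝ) - N)) = k * 2 ^ N := by
    rw [← Finset.mul_sum, Finset.sum_add_distrib, hsumr]
    simp [mul_comm]
  have hge : ∀ i, N ≤ v i := by
    by_contra! hlt
    obtain ⟨i, hi⟩ := hlt
    have h3 : ∑ j, ((2 : ℝ) ^ N * (1 + ((v j : ℝ) - N)) + if j = i then 2 ^ N / 2 else 0) ≤
        ∑ j, (2 : ℝ) ^ v j := by
      refine Finset.sum_le_sum fun j _ => ?_
      split_ifs with hj
      · exact hterm' _ (hj ▸ hi)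
      · simpa using hterm (v j)
    rw [Finset.sum_add_distrib, hall] at h3
    simp at h3
    linarith
  refine le_antisymm ?_ (hge i)
  by_contra! hlt
  have : ∑ i : Fin k, N < ∑ i, v i :=
    Finset.sum_lt_sum (fun i _ => hge i) ⟨i, Finset.mem_univ _, hlt⟩
  simp [hsum] at this

/-- Let `W i` consist of the elements lying in more than a fraction `β` of the members of the
family `C i`. If nearly all pairs of members of different families are disjoint, then so are the
sets `W i`, and counting shows that they have equal sizes and that `C i` contains almost all
subsets of `W i`. -/
lemma exists_partition_of_families {X : Type*} [Fintype X] [DecidableEq X] {k N : ℕ}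
    (hX : Fintype.card X = k * N) (C : Fin k → Finset (Finset X)) {β ε γ : ℝ} (hβ : 0 ≤ β)
    (hε : 0 ≤ ε) (hεβ : 2 * ε ≤ β ^ 2)
    (hγ : γ = ε + k * (Fintype.card X * β)) (hγ1 : (2 * k + 1) * γ < 1)
    (h1 : (1 - ε) * (2 ^ N) ^ k ≤ ∏ i, ((C i).card : ℝ))
    (h2 : ∑ i, ((C i).card : ℝ) ≤ k * 2 ^ N)
    (h3 : ∀ i j, i ≠ j → (((C i ×ˢ C j).filter fun p => ¬ Disjoint p.1 p.2).card : ℝ) ≤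
      2 * ε * ((C i).card * (C j).card)) :
    ∃ W : Fin k → Finset X, (∀ i j, i ≠ j → Disjoint (W i) (W j)) ∧ (∀ i, (W i).card = N) ∧
      ∀ i, (((W i).powerset \ C i).card : ℝ) ≤ 2 * γ * 2 ^ N := by
  rcases Nat.eq_zero_or_pos k with rfl | hk
  · exact ⟨fun _ => ∅, fun i => i.elim0, fun i => i.elim0, fun i => i.elim0⟩
  have hk1 : (1 : ℝ) ≤ k := by exact_mod_cast hk
  set n := (Fintype.card X : ℝ) with hn
  have hn0 : 0 ≤ n := Nat.cast_nonneg _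
  have hnβ : 0 ≤ n * β := mul_nonneg hn0 hβ
  have hq : (0 : ℝ) < 2 ^ N := by positivity
  have hγ0 : 0 ≤ γ := by rw [hγ]; positivity
  have hγ3 : γ < 1 / 3 := by nlinarith
  have hnβγ : n * β ≤ γ := by rw [hγ]; nlinarith
  have hε1 : ε ≤ γ := by rw [hγ]; have := mul_nonneg (zero_le_one.trans hk1) hnβ; linarith
  set m : Fin k → ℝ := fun i => ((C i).card : ℝ) with hm
  have hm0 : ∀ i, 0 ≤ m i := fun i => Nat.cast_nonneg _
  have hprodpos : 0 < ∏ i, m i := lt_of_lt_of_le (mul_pos (by linarith) (by positivity)) h1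
  have hmpos : ∀ i, 0 < m i := fun i =>
    (hm0 i).lt_of_ne fun h => hprodpos.ne (Finset.prod_eq_zero (Finset.mem_univ i) h.symm).symm
  let W : Fin k → Finset X := fun i =>
    Finset.univ.filter fun x => β * m i < ((C i).filter fun A => x ∈ A).card
  have hdisj : ∀ i j, i ≠ j → Disjoint (W i) (W j) := by
    intro i j hij
    rw [Finset.disjoint_left]
    intro x hxi hxj
    have hxi := (Finset.mem_filter.1 hxi).2
    have hxj := (Finset.mem_filter.1 hxj).2
    have hsub : ((C i).filter fun A => x ∈ A) ×ˢ ((C j).filter fun A => x ∈ A) ⊆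
        (C i ×ˢ C j).filter fun p => ¬ Disjoint p.1 p.2 := by
      rintro ⟨A, B⟩ h
      simp only [Finset.mem_product, Finset.mem_filter] at h ⊢
      exact ⟨⟨h.1.1, h.2.1⟩, Finset.not_disjoint_iff.2 ⟨x, h.1.2, h.2.2⟩⟩
    have hle : (((C i).filter fun A => x ∈ A).card : ℝ) * ((C j).filter fun A => x ∈ A).card ≤
        2 * ε * (m i * m j) := by
      refine le_trans ?_ (h3 i j hij)
      rw [← Nat.cast_mul, ← Finset.card_product]
      exact_mod_cast Finset.card_le_card hsub
    have hlt : (β * m i) * (β * m j) <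
        (((C i).filter fun A => x ∈ A).card : ℝ) * ((C j).filter fun A => x ∈ A).card :=
      mul_lt_mul'' hxi hxj (mul_nonneg hβ (hm0 i)) (mul_nonneg hβ (hm0 j))
    have : 2 * ε * (m i * m j) ≤ β ^ 2 * (m i * m j) :=
      mul_le_mul_of_nonneg_right hεβ (mul_nonneg (hm0 i) (hm0 j))
    linarith
  set l := 1 - n * β with hl
  have hl0 : 0 < l := by linarith
  have hl1 : l ≤ 1 := by linarith
  -- Only few members of `C i` are not contained in `W i`.
  have hin : ∀ i, l * m i ≤ ((C i ∩ (W i).powerset).card : ℝ) := by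
    intro i
    have hsub : C i \ (W i).powerset ⊆
        (W i)ᶜ.biUnion fun x => (C i).filter fun A => x ∈ A := by
      intro A hA
      obtain ⟨hA1, hA2⟩ := Finset.mem_sdiff.1 hA
      rw [Finset.mem_powerset, Finset.not_subset] at hA2
      obtain ⟨x, hxA, hxW⟩ := hA2
      exact Finset.mem_biUnion.2 ⟨x, Finset.mem_compl.2 hxW, Finset.mem_filter.2 ⟨hA1, hxA⟩⟩
    have hle : ((C i \ (W i).powerset).card : ℝ) ≤ n * (β * m i) := by
      calc ((C i \ (W i).powerset).card : ℝ)
          ≤ ∑ x ∈ (W i)ᶜ, (((C i).filter fun A => x ∈ A).card : ℝ) := by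
            exact_mod_cast (Finset.card_le_card hsub).trans Finset.card_biUnion_le
        _ ≤ ∑ x ∈ (W i)ᶜ, β * m i := by
            refine Finset.sum_le_sum fun x hx => ?_
            by_contra! hlt
            exact Finset.mem_compl.1 hx (Finset.mem_filter.2 ⟨Finset.mem_univ _, hlt⟩)
        _ = ((W i)ᶜ.card : ℝ) * (β * m i) := by simp
        _ ≤ n * (β * m i) := by
            have := hm0 i
            gcongr
            exact Nat.cast_le.2 (Finset.card_le_univ _)
    have hadd : ((C i ∩ (W i).powerset).card : ℝ) + (C i \ (W i).powerset).card = m i := by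
      change _ = ((C i).card : ℝ)
      exact_mod_cast Finset.card_inter_add_card_sdiff (C i) (W i).powerset
    rw [hl]
    linarith
  have ha : ∀ i, l * m i ≤ (2 : ℝ) ^ (W i).card := by
    intro i
    refine (hin i).trans ?_
    have : (C i ∩ (W i).powerset).card ≤ 2 ^ (W i).card := by
      rw [← Finset.card_powerset]
      exact Finset.card_le_card Finset.inter_subset_right
    exact_mod_cast this
  have hbern : ∀ j : ℕ, j ≤ k → 1 - γ ≤ (1 - ε) * l ^ j := by
    intro j hj
    have hjk : (j : ℝ) ≤ k := by exact_mod_cast hj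
    have hb := one_add_mul_le_pow (show (-2 : ℝ) ≤ -(n * β) by linarith) j
    have hb' : 1 - k * (n * β) ≤ l ^ j := by
      have : (j : ℝ) * (n * β) ≤ k * (n * β) := by gcongr
      rw [hl, sub_eq_add_neg (1 : ℝ) (n * β)]
      linarith
    calc 1 - γ ≤ (1 - ε) * (1 - k * (n * β)) := by
          have : 0 ≤ ε * (k * (n * β)) := by positivity
          rw [hγ]
          linarith
      _ ≤ (1 - ε) * l ^ j := by
          have : 0 ≤ 1 - ε := by linarith
          gcongr
  -- The sets `W i` cover the ground set.
  have hWle : ∑ i, (W i).card ≤ k * N := by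
    rw [← hX, ← Finset.card_biUnion (fun i _ j _ hij => hdisj i j hij)]
    exact Finset.card_le_univ _
  have hprodW : ∏ i, (2 : ℝ) ^ (W i).card = 2 ^ ∑ i, (W i).card := by
    rw [Finset.prod_pow_eq_pow_sum]
  have hWsum : ∑ i, (W i).card = k * N := by
    refine le_antisymm hWle ?_
    by_contra! hlt
    have e1 : l ^ k * ∏ i, m i ≤ 2 ^ ∑ i, (W i).card := by
      rw [← hprodW]
      calc l ^ k * ∏ i, m i = ∏ i, l * m i := by
            rw [Finset.prod_mul_distrib, Finset.prod_const, Finset.card_univ, Fintype.card_fin]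
        _ ≤ _ := Finset.prod_le_prod (fun i _ => mul_nonneg hl0.le (hm0 i)) fun i _ => ha i
    have e2 : (2 : ℝ) ^ (∑ i, (W i).card) * 2 ≤ (2 ^ N) ^ k := by
      rw [← pow_succ, ← pow_mul]
      exact pow_le_pow_right₀ (by norm_num) (by rw [mul_comm N k]; exact hlt)
    have e3 : (1 - γ) * (2 ^ N) ^ k ≤ l ^ k * ∏ i, m i := by
      calc (1 - γ) * (2 ^ N) ^ k ≤ ((1 - ε) * l ^ k) * (2 ^ N) ^ k := by
            gcongr
            exact hbern k le_rfl
        _ = l ^ k * ((1 - ε) * (2 ^ N) ^ k) := by ring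
        _ ≤ _ := by gcongr
    have e4 : (0 : ℝ) < (2 ^ N) ^ k := by positivity
    nlinarith
  have hma : ∀ i, (1 - γ) * 2 ^ (W i).card ≤ m i := by
    intro i
    set P := ∏ j ∈ Finset.univ.erase i, (2 : ℝ) ^ (W j).card with hP
    set M := ∏ j ∈ Finset.univ.erase i, m j with hM
    have hP0 : 0 < P := Finset.prod_pos fun _ _ => by positivity
    have e1 : 2 ^ (W i).card * P = (2 ^ N) ^ k := by
      rw [hP, Finset.mul_prod_erase _ (fun j => (2 : ℝ) ^ (W j).card) (Finset.mem_univ i),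
        hprodW, hWsum, ← pow_mul, mul_comm]
    have e2 : m i * M = ∏ j, m j := Finset.mul_prod_erase _ _ (Finset.mem_univ i)
    have e3 : l ^ (k - 1) * M ≤ P := by
      calc l ^ (k - 1) * M = ∏ j ∈ Finset.univ.erase i, l * m j := by
            rw [Finset.prod_mul_distrib, Finset.prod_const,
              Finset.card_erase_of_mem (Finset.mem_univ i), Finset.card_univ, Fintype.card_fin]
        _ ≤ _ := Finset.prod_le_prod (fun i _ => mul_nonneg hl0.le (hm0 i)) fun i _ => ha i
    refine le_of_mul_le_mul_right ?_ hP0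
    calc (1 - γ) * 2 ^ (W i).card * P = (1 - γ) * (2 ^ N) ^ k := by rw [mul_assoc, e1]
      _ ≤ ((1 - ε) * l ^ (k - 1)) * (2 ^ N) ^ k := by
          gcongr
          exact hbern _ (Nat.sub_le _ _)
      _ = l ^ (k - 1) * ((1 - ε) * (2 ^ N) ^ k) := by ring
      _ ≤ l ^ (k - 1) * (m i * M) := by rw [e2]; gcongr
      _ = m i * (l ^ (k - 1) * M) := by ring
      _ ≤ m i * P := by
          have := hm0 i
          gcongr
  have hWN : ∀ i, (W i).card = N := by
    refine eq_of_sum_two_pow_lt (fun i => (W i).card) hWsum ?_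
    have e1 : (1 - γ) * ∑ i, (2 : ℝ) ^ (W i).card ≤ k * 2 ^ N := by
      rw [Finset.mul_sum]
      exact (Finset.sum_le_sum fun i _ => hma i).trans h2
    by_contra! hlt
    have e2 : (1 - γ) * ((k + 1 / 2) * 2 ^ N) ≤ k * 2 ^ N :=
      le_trans (mul_le_mul_of_nonneg_left hlt (by linarith)) e1
    nlinarith
  refine ⟨W, hdisj, hWN, fun i => ?_⟩
  have e1 : (((W i).powerset \ C i).card : ℝ) + (C i ∩ (W i).powerset).card = 2 ^ N := by
    rw [Finset.inter_comm, add_comm, ← hWN i]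
    exact_mod_cast (Finset.card_inter_add_card_sdiff (W i).powerset (C i)).trans
      (Finset.card_powerset _)
  have e2 := hin i
  have e3 := hma i
  rw [hWN i] at e3
  have e4 : l * ((1 - γ) * 2 ^ N) ≤ l * m i := by gcongr
  have e5 : (1 - 2 * γ) * 2 ^ N ≤ l * ((1 - γ) * 2 ^ N) := by
    rw [← mul_assoc]
    gcongr
    rw [hl]
    have : 0 ≤ n * β * γ := by positivity
    linarith
  linarith

/-! ### Generators containing almost all subsets of the classes of a partition -/

/-- At least a proportion `2 ^ (-s)` of the subsets of `V` contains none of `s` given nonempty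
traces on `V`: it suffices to avoid one element of each. -/
lemma le_two_pow_mul_of_card_avoid {α : Type*} [DecidableEq α] (V : Finset α)
    (E : Finset (Finset α)) (hE : ∀ e ∈ E, (e ∩ V).Nonempty) :
    (2 : ℝ) ^ V.card ≤
      2 ^ E.card * ((V.powerset.filter fun z => ∀ e ∈ E, ¬ e ∩ V ⊆ z).card : ℝ) := by
  classical
  choose h hh using hE
  set H := E.attach.image (fun e => h e.1 e.2) with hH
  have hHV : H ⊆ V := by
    intro x hx
    obtain ⟨e, -, rfl⟩ := Finset.mem_image.1 hx
    exact (Finset.mem_inter.1 (hh e.1 e.2)).2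
  have hsub : (V \ H).powerset ⊆ V.powerset.filter fun z => ∀ e ∈ E, ¬ e ∩ V ⊆ z := by
    intro z hz
    rw [Finset.mem_powerset] at hz
    refine Finset.mem_filter.2 ⟨Finset.mem_powerset.2 (hz.trans Finset.sdiff_subset), ?_⟩
    intro e he hez
    exact (Finset.mem_sdiff.1 (hz (hez (hh e he)))).2
      (Finset.mem_image.2 ⟨⟨e, he⟩, Finset.mem_attach _ _, rfl⟩)
  have hcard : 2 ^ V.card ≤
      2 ^ E.card * (V.powerset.filter fun z => ∀ e ∈ E, ¬ e ∩ V ⊆ z).card := by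
    calc 2 ^ V.card = 2 ^ H.card * 2 ^ (V \ H).card := by
          rw [← pow_add, add_comm, Finset.card_sdiff_add_card_eq_card hHV]
      _ ≤ 2 ^ E.card * (V \ H).powerset.card := by
          rw [Finset.card_powerset]
          gcongr
          · norm_num
          · exact Finset.card_image_le.trans_eq E.card_attach
      _ ≤ _ := by gcongr
  exact_mod_cast hcard

/-- Counting the sets with a trace in `M` on `V` by the trace and by the part outside `V`. -/
lemma card_filter_inter_mem {X : Type*} [Fintype X] [DecidableEq X] (V : Finset X)
    (M : Finset (Finset X)) (hM : ∀ y ∈ M, y ⊆ V) (P : Finset X → Finset X → Prop)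
    [∀ y, DecidablePred (P y)] [DecidablePred fun x => x ∩ V ∈ M ∧ P (x ∩ V) (x \ V)] :
    (Finset.univ.filter fun x : Finset X => x ∩ V ∈ M ∧ P (x ∩ V) (x \ V)).card =
      ∑ y ∈ M, (Vᶜ.powerset.filter fun z => P y z).card := by
  classical
  rw [← Finset.card_sigma]
  have hV : ∀ y ∈ M, ∀ z ⊆ Vᶜ, (y ∪ z) ∩ V = y ∧ (y ∪ z) \ V = z := by
    intro y hy z hz
    have h1 := hM y hy
    have h2 : Disjoint z V := (Finset.subset_compl_iff_disjoint_right).1 hz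
    constructor
    · rw [Finset.union_inter_distrib_right, Finset.inter_eq_left.2 h1,
        Finset.disjoint_iff_inter_eq_empty.1 h2, Finset.union_empty]
    · rw [Finset.union_sdiff_distrib, Finset.sdiff_eq_empty_iff_subset.2 h1,
        Finset.sdiff_eq_self_of_disjoint h2, Finset.empty_union]
  refine Finset.card_bij' (fun x _ => ⟨x ∩ V, x \ V⟩) (fun p _ => p.1 ∪ p.2) ?_ ?_ ?_ ?_
  · intro x hx
    obtain ⟨-, h1, h2⟩ := Finset.mem_filter.1 hx
    refine Finset.mem_sigma.2 ⟨h1, Finset.mem_filter.2 ⟨Finset.mem_powerset.2 ?_, h2⟩⟩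
    intro a ha
    exact Finset.mem_compl.2 (Finset.mem_sdiff.1 ha).2
  · rintro ⟨y, z⟩ hp
    obtain ⟨h1, h2⟩ := Finset.mem_sigma.1 hp
    obtain ⟨h2, h3⟩ := Finset.mem_filter.1 h2
    obtain ⟨e1, e2⟩ := hV y h1 z (Finset.mem_powerset.1 h2)
    refine Finset.mem_filter.2 ⟨Finset.mem_univ _, ?_⟩
    rw [e1, e2]
    exact ⟨h1, h3⟩
  · intro x _
    exact (Finset.union_comm _ _).trans (Finset.sdiff_union_inter x V)
  · rintro ⟨y, z⟩ hp
    obtain ⟨h1, h2⟩ := Finset.mem_sigma.1 hp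
    obtain ⟨h2, h3⟩ := Finset.mem_filter.1 h2
    obtain ⟨e1, e2⟩ := hV y h1 z (Finset.mem_powerset.1 h2)
    simp [e1, e2]

/-- A generator `G` fails to contain some nonempty subset `x ∩ W i` of a class `W i`. Then in a
representation of `x` either a member meeting several classes has the trace `x ∩ W i` on `W i`, or
`x` agrees on some other class with such a member or with the empty set, or two members of the
representation meet several classes. -/
lemma exists_of_inter_notMem {X : Type*} [Fintype X] [DecidableEq X] {k : ℕ}
    {G : Finset (Finset X)} (hG : IsKGenerator k G) (h0 : ∅ ∉ G) {W : Fin k → Finset X}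
    (hW : ∀ i j, i ≠ j → Disjoint (W i) (W j)) {E : Finset (Finset X)}
    (hE : ∀ e, e ∈ E ↔ e ∈ G ∧ ∀ i, ¬ e ⊆ W i) (x : Finset X) (i : Fin k)
    (hx0 : (x ∩ W i).Nonempty) (hx : x ∩ W i ∉ G) :
    (∃ e ∈ E, e ⊆ x ∧ e ∩ W i = x ∩ W i) ∨
    (∃ j, j ≠ i ∧ ∃ e ∈ insert ∅ E, x ∩ W j = e ∩ W j) ∨
    ∃ S ⊆ G, S.card ≤ k ∧ S.biUnion id = x ∧ ∃ e ∈ S, ∃ f ∈ S, e ≠ f ∧ e ∈ E ∧ f ∈ E := by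
  obtain ⟨S, hSG, hSk, hSd, hSx⟩ := hG x
  by_cases h2 : ∃ e ∈ S, ∃ f ∈ S, e ≠ f ∧ e ∈ E ∧ f ∈ E
  · exact Or.inr (Or.inr ⟨S, hSG, hSk, hSx, h2⟩)
  push Not at h2
  have hmem : ∀ {a}, a ∈ x ↔ ∃ s ∈ S, a ∈ s := by
    intro a
    rw [← hSx]
    simp
  have hsub : ∀ s ∈ S, s ⊆ x := fun s hs a ha => hmem.2 ⟨s, hs, ha⟩
  -- A member of `S` outside `E` is contained in exactly one class.
  have hcl : ∀ s ∈ S, s ∉ E → ∃ j, s ⊆ W j := by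
    intro s hs hsE
    by_contra! hne
    exact hsE ((hE s).2 ⟨hSG hs, hne⟩)
  have hone : ∀ s ∈ S, ∀ j l, s ⊆ W j → s ⊆ W l → j = l := by
    intro s hs j l hj hl
    by_contra hne
    have : s = ∅ := Finset.disjoint_self_iff_empty _ |>.1
      ((hW j l hne).mono hj hl)
    exact h0 (this ▸ hSG hs)
  -- Some class contains no member of `S`.
  have hmiss : ∃ j, ∀ s ∈ S, ¬ s ⊆ W j := by
    by_contra! hall
    choose g hgS hgW using hall
    have hginj : Function.Injective g := by
      intro a b hab
      exact hone _ (hgS a) a b (hgW a) (hab ▸ hgW b)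
    have himg : Finset.univ.image g = S := by
      refine Finset.eq_of_subset_of_card_le ?_ ?_
      · intro s hs
        obtain ⟨a, -, rfl⟩ := Finset.mem_image.1 hs
        exact hgS a
      · rw [Finset.card_image_of_injective _ hginj]
        simpa using hSk
    have : x ∩ W i = g i := by
      ext a
      rw [Finset.mem_inter]
      constructor
      · rintro ⟨ha, hai⟩
        obtain ⟨s, hs, has⟩ := hmem.1 ha
        rw [← himg] at hs
        obtain ⟨l, -, rfl⟩ := Finset.mem_image.1 hs
        by_cases hl : l = i
        · exact hl ▸ has
        · exact absurd hai (Finset.disjoint_left.1 (hW l i hl) (hgW l has))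
      · intro ha
        exact ⟨hsub _ (hgS i) ha, hgW i ha⟩
    exact hx (this ▸ hSG (hgS i))
  obtain ⟨j, hj⟩ := hmiss
  by_cases hSE : ∃ e ∈ S, e ∈ E
  · obtain ⟨e, heS, heE⟩ := hSE
    have hej : x ∩ W j = e ∩ W j := by
      refine Finset.Subset.antisymm ?_ (Finset.inter_subset_inter_right (hsub e heS))
      intro a ha
      obtain ⟨hax, haj⟩ := Finset.mem_inter.1 ha
      obtain ⟨s, hs, has⟩ := hmem.1 hax
      by_cases hsE : s ∈ E
      · have : s = e := by
          by_contra hne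
          exact h2 s hs e heS hne hsE heE
        exact Finset.mem_inter.2 ⟨this ▸ has, haj⟩
      · obtain ⟨l, hl⟩ := hcl s hs hsE
        by_cases hlj : l = j
        · exact absurd (hlj ▸ hl) (hj s hs)
        · exact absurd haj (Finset.disjoint_left.1 (hW l j hlj) (hl has))
    by_cases hji : j = i
    · subst hji
      exact Or.inl ⟨e, heE, hsub e heS, hej.symm⟩
    · exact Or.inr (Or.inl ⟨j, hji, e, Finset.mem_insert_of_mem heE, hej⟩)
  · push Not at hSE
    have hej : x ∩ W j = ∅ := by
      rw [Finset.eq_empty_iff_forall_notMem]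
      intro a ha
      obtain ⟨hax, haj⟩ := Finset.mem_inter.1 ha
      obtain ⟨s, hs, has⟩ := hmem.1 hax
      obtain ⟨l, hl⟩ := hcl s hs (hSE s hs)
      by_cases hlj : l = j
      · exact absurd (hlj ▸ hl) (hj s hs)
      · exact absurd haj (Finset.disjoint_left.1 (hW l j hlj) (hl has))
    have hji : j ≠ i := by
      rintro rfl
      rw [hej] at hx0
      exact Finset.not_nonempty_empty hx0
    exact Or.inr (Or.inl ⟨j, hji, ∅, Finset.mem_insert_self _ _, by simp [hej]⟩)

lemma exists_tuple_biUnion_eq {X : Type*} [DecidableEq X] {K : ℕ} (T : Finset (Finset X))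
    (h : T.card ≤ K) : ∃ g : Fin K → Finset X,
      (∀ i, g i ∈ insert ∅ T) ∧ Finset.univ.biUnion g = T.biUnion id := by
  let g : Fin K → Finset X := fun i =>
    if hi : (i : ℕ) < T.card then (T.equivFin.symm ⟨i, hi⟩ : T).1 else ∅
  have hg : ∀ i, g i ∈ insert ∅ T := by
    intro i
    by_cases hi : (i : ℕ) < T.card
    · simp only [g, hi, dif_pos]
      exact Finset.mem_insert_of_mem (T.equivFin.symm ⟨i, hi⟩ : T).2
    · simp [g, hi]
  refine ⟨g, hg, ?_⟩
  ext a
  simp only [Finset.mem_biUnion, Finset.mem_univ, true_and, id]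
  constructor
  · rintro ⟨i, hi⟩
    rcases Finset.mem_insert.1 (hg i) with h0 | hT
    · rw [h0] at hi
      exact absurd hi (Finset.notMem_empty a)
    · exact ⟨_, hT, hi⟩
  · rintro ⟨s, hs, ha⟩
    refine ⟨⟨T.equivFin ⟨s, hs⟩, lt_of_lt_of_le (T.equivFin ⟨s, hs⟩).2 h⟩, ?_⟩
    simpa [g] using ha

/-- A bound for the number of the sets with two members of `E` in a representation. -/
lemma card_le_of_two_members {X : Type*} [Fintype X] [DecidableEq X] {K : ℕ}
    {G E : Finset (Finset X)} (U : Finset (Finset X))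
    (hU : ∀ x ∈ U, ∃ S ⊆ G, S.card ≤ K + 2 ∧ S.biUnion id = x ∧
      ∃ e ∈ S, ∃ f ∈ S, e ≠ f ∧ e ∈ E ∧ f ∈ E) :
    U.card ≤ E.card * E.card * (G.card + 1) ^ K := by
  classical
  have hsub : U ⊆ ((E ×ˢ E) ×ˢ Fintype.piFinset fun _ : Fin K => insert ∅ G).image
      fun p => (p.1.1 ∪ p.1.2) ∪ Finset.univ.biUnion p.2 := by
    intro x hx
    obtain ⟨S, hSG, hSk, rfl, e, he, f, hf, hef, heE, hfE⟩ := hU x hx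
    obtain ⟨g, hg, hgS⟩ := exists_tuple_biUnion_eq (K := K) ((S.erase e).erase f) (by
      rw [Finset.card_erase_of_mem (Finset.mem_erase.2 ⟨hef.symm, hf⟩),
        Finset.card_erase_of_mem he]
      omega)
    refine Finset.mem_image.2 ⟨((e, f), g), ?_, ?_⟩
    · refine Finset.mem_product.2 ⟨Finset.mem_product.2 ⟨heE, hfE⟩, Fintype.mem_piFinset.2 ?_⟩
      intro i
      refine Finset.insert_subset_insert ∅ ?_ (hg i)
      exact ((Finset.erase_subset _ _).trans (Finset.erase_subset _ _)).trans hSG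
    · dsimp only
      rw [hgS]
      conv_rhs => rw [← Finset.insert_erase he,
        ← Finset.insert_erase (Finset.mem_erase.2 ⟨hef.symm, hf⟩ : f ∈ S.erase e),
        Finset.biUnion_insert, Finset.biUnion_insert, ← Finset.union_assoc]
      rfl
  refine (Finset.card_le_card hsub).trans (Finset.card_image_le.trans ?_)
  rw [Finset.card_product, Finset.card_product, Fintype.card_piFinset, Finset.prod_const,
    Finset.card_univ, Fintype.card_fin]
  gcongr
  exact Finset.card_insert_le _ _

/-- The sets with a trace in `M` on `V` and a prescribed trace on the disjoint set `B`. -/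
lemma card_inter_mem_inter_eq_le {X : Type*} [Fintype X] [DecidableEq X] {V B : Finset X}
    (hVB : Disjoint V B) {M : Finset (Finset X)} (hM : ∀ y ∈ M, y ⊆ V) (b : Finset X) :
    (Finset.univ.filter fun x : Finset X => x ∩ V ∈ M ∧ x ∩ B = b).card ≤
      M.card * 2 ^ (Fintype.card X - (V.card + B.card)) := by
  have h1 : (Finset.univ.filter fun x : Finset X => x ∩ V ∈ M ∧ x ∩ B = b) ⊆
      Finset.univ.filter fun x : Finset X => x ∩ V ∈ M ∧ (x \ V) ∩ B = b := by
    intro x hx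
    obtain ⟨-, hx1, hx2⟩ := Finset.mem_filter.1 hx
    refine Finset.mem_filter.2 ⟨Finset.mem_univ _, hx1, ?_⟩
    rw [← hx2]
    ext a
    simp only [Finset.mem_inter, Finset.mem_sdiff]
    constructor
    · exact fun h => ⟨h.1.1, h.2⟩
    · exact fun h => ⟨⟨h.1, fun hV => Finset.disjoint_left.1 hVB hV h.2⟩, h.2⟩
  refine (Finset.card_le_card h1).trans ?_
  rw [card_filter_inter_mem V M hM (fun _ z => z ∩ B = b), Finset.sum_const, smul_eq_mul]
  gcongr
  calc (Vᶜ.powerset.filter fun z => z ∩ B = b).card ≤ ((V ∪ B)ᶜ).powerset.card := by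
        refine Finset.card_le_card_of_injOn (fun z => z \ B) ?_ ?_
        · intro z hz
          obtain ⟨hz, -⟩ := Finset.mem_filter.1 hz
          rw [Finset.mem_powerset] at hz
          refine Finset.mem_powerset.2 fun a ha => ?_
          obtain ⟨ha1, ha2⟩ := Finset.mem_sdiff.1 ha
          have := hz ha1
          simp only [Finset.mem_compl, Finset.mem_union] at this ⊢
          tauto
        · intro z hz w hw hzw
          have hz := (Finset.mem_filter.1 hz).2
          have hw := (Finset.mem_filter.1 hw).2
          rw [← Finset.sdiff_union_inter z B, ← Finset.sdiff_union_inter w B, hz, hw]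
          exact congrArg (· ∪ b) hzw
    _ = _ := by
        rw [Finset.card_powerset, Finset.card_compl, Finset.card_union_of_disjoint hVB]

lemma one_sub_div_le_one_div_two_pow (k s : ℕ) (hk : 1 ≤ k) :
    1 / 4 ^ k * (1 - (s : ℝ) / (2 * k)) ≤ 1 / 2 ^ s := by
  have hk0 : (0 : ℝ) < k := by exact_mod_cast hk
  rcases le_total s (2 * k) with h | h
  · have h1 : (2 : ℝ) ^ s ≤ 4 ^ k := by
      rw [show (4 : ℝ) = 2 ^ 2 by norm_num, ← pow_mul]
      exact pow_le_pow_right₀ (by norm_num) h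
    calc 1 / 4 ^ k * (1 - (s : ℝ) / (2 * k)) ≤ 1 / 4 ^ k * 1 := by
          gcongr
          have : 0 ≤ (s : ℝ) / (2 * k) := by positivity
          linarith
      _ ≤ 1 / 2 ^ s := by
          rw [mul_one]
          gcongr
  · have h1 : (1 : ℝ) ≤ (s : ℝ) / (2 * k) := by
      rw [le_div_iff₀ (by positivity), one_mul]
      exact_mod_cast h
    exact (mul_nonpos_of_nonneg_of_nonpos (by positivity) (by linarith)).trans (by positivity)

/-- The number of members of a generator meeting several classes is at most the number of nonempty
subsets of the classes that are missing, if the generator is not larger than the family of all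
these subsets. -/
lemma card_extra_le {X : Type*} [DecidableEq X] {k N : ℕ} {G : Finset (Finset X)}
    (h0 : ∅ ∉ G) (hcard : G.card + k ≤ k * 2 ^ N) {W : Fin k → Finset X}
    (hW : ∀ i j, i ≠ j → Disjoint (W i) (W j)) (hWN : ∀ i, (W i).card = N) :
    (G.filter fun e => ∀ i, ¬ e ⊆ W i).card ≤ ∑ i, ((W i).powerset \ insert ∅ G).card := by
  have hpow : ∀ i, (G.filter fun e => e ⊆ W i).card + 1 + ((W i).powerset \ insert ∅ G).card =
      2 ^ N := by
    intro i
    rw [← hWN i, ← Finset.card_powerset,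
      ← Finset.card_inter_add_card_sdiff (W i).powerset (insert ∅ G)]
    congr 1
    rw [← Finset.card_insert_of_notMem (a := ∅) (fun h => h0 (Finset.mem_filter.1 h).1)]
    congr 1
    ext e
    simp only [Finset.mem_insert, Finset.mem_filter, Finset.mem_inter, Finset.mem_powerset]
    constructor
    · rintro (rfl | ⟨h1, h2⟩)
      · exact ⟨Finset.empty_subset _, Or.inl rfl⟩
      · exact ⟨h2, Or.inr h1⟩
    · rintro ⟨h1, h2 | h2⟩
      · exact Or.inl h2
      · exact Or.inr ⟨h2, h1⟩
  have hsum := Finset.sum_congr rfl fun i (_ : i ∈ (Finset.univ : Finset (Fin k))) => hpow i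
  rw [Finset.sum_add_distrib, Finset.sum_add_distrib] at hsum
  simp only [Finset.sum_const, Finset.card_univ, Fintype.card_fin, smul_eq_mul, mul_one] at hsum
  have hdisj : ∑ i, (G.filter fun e => e ⊆ W i).card =
      (Finset.univ.biUnion fun i => G.filter fun e => e ⊆ W i).card := by
    refine (Finset.card_biUnion ?_).symm
    intro i _ j _ hij
    refine Finset.disjoint_left.2 fun e hi hj => ?_
    have : e = ∅ := (Finset.disjoint_self_iff_empty _).1
      ((hW i j hij).mono (Finset.mem_filter.1 hi).2 (Finset.mem_filter.1 hj).2)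
    exact h0 (this ▸ (Finset.mem_filter.1 hi).1)
  have hG : (G.filter fun e => ∀ i, ¬ e ⊆ W i).card +
      (Finset.univ.biUnion fun i => G.filter fun e => e ⊆ W i).card ≤ G.card := by
    rw [← Finset.card_union_of_disjoint]
    · refine Finset.card_le_card (Finset.union_subset (Finset.filter_subset _ _) ?_)
      exact Finset.biUnion_subset.2 fun i _ => Finset.filter_subset _ _
    · rw [Finset.disjoint_left]
      intro e h1 h2
      obtain ⟨i, -, hi⟩ := Finset.mem_biUnion.1 h2
      exact (Finset.mem_filter.1 h1).2 i (Finset.mem_filter.1 hi).2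
  omega

/-- A generator of at most the canonical size which contains almost all subsets of each class of a
partition into equal classes consists of the nonempty subsets of the classes. Otherwise, let `W i`
be the class with the largest number of missing subsets. Nearly every `x` whose trace on `W i` is
missing contains a member of the generator that meets several classes and has the same trace on
`W i`. For most of the missing traces this takes more such members than there are. -/
lemma mem_iff_of_few_missing {X : Type*} [Fintype X] [DecidableEq X] {K N : ℕ}
    (hX : Fintype.card X = (K + 2) * N)
    {G : Finset (Finset X)} (hG : IsKGenerator (K + 2) G) (h0 : ∅ ∉ G)
    (hcard : G.card + (K + 2) ≤ (K + 2) * 2 ^ N) {W : Fin (K + 2) → Finset X}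
    (hW : ∀ i j, i ≠ j → Disjoint (W i) (W j)) (hWN : ∀ i, (W i).card = N) {δ : ℝ}
    (hM : ∀ i, (((W i).powerset \ insert ∅ G).card : ℝ) ≤ δ * 2 ^ N)
    (hδ : 2 * 4 ^ (K + 2) * ((K + 2) * ((K + 2) * δ + 1 / 2 ^ N) + (K + 2) ^ (K + 2) * δ) < 1)
    (A : Finset X) : A ∈ G ↔ A ≠ ∅ ∧ ∃ i, A ⊆ W i := by
  classical
  set k : ℝ := (K : ℝ) + 2 with hk
  have hk0 : 0 < k := by positivity
  set q : ℝ := 2 ^ N with hq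
  have hq0 : 0 < q := by positivity
  set M : Fin (K + 2) → Finset (Finset X) := fun i => (W i).powerset \ insert ∅ G with hMdef
  set E := G.filter fun e => ∀ i, ¬ e ⊆ W i with hE
  have hEmem : ∀ e, e ∈ E ↔ e ∈ G ∧ ∀ i, ¬ e ⊆ W i := fun e => Finset.mem_filter
  have hEM : E.card ≤ ∑ i, (M i).card := card_extra_le h0 hcard hW hWN
  obtain ⟨i, -, hi⟩ := Finset.exists_max_image Finset.univ (fun i => (M i).card)
    ⟨0, Finset.mem_univ _⟩
  rcases Nat.eq_zero_or_pos (M i).card with hμ | hμ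
  · have hM0 : ∀ j, (M j).card = 0 := fun j => by
      have := hi j (Finset.mem_univ _)
      omega
    have hE0 : E = ∅ := by
      rw [← Finset.card_eq_zero]
      simpa [hM0] using hEM
    constructor
    · intro hA
      refine ⟨fun h => h0 (h ▸ hA), ?_⟩
      by_contra! hne
      have : A ∈ E := (hEmem A).2 ⟨hA, hne⟩
      rw [hE0] at this
      exact Finset.notMem_empty _ this
    · rintro ⟨hA, j, hj⟩
      by_contra hAG
      have : A ∈ M j := Finset.mem_sdiff.2 ⟨Finset.mem_powerset.2 hj, by simp [hA, hAG]⟩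
      rw [Finset.card_eq_zero.1 (hM0 j)] at this
      exact Finset.notMem_empty _ this
  exfalso
  set μ : ℝ := ((M i).card : ℝ) with hμdef
  have hμ0 : 0 < μ := Nat.cast_pos.2 hμ
  have hMV : ∀ y ∈ M i, y ⊆ W i := fun y hy => Finset.mem_powerset.1 (Finset.mem_sdiff.1 hy).1
  have hEk : (E.card : ℝ) ≤ k * μ := by
    have h1 : E.card ≤ (K + 2) * (M i).card := by
      refine hEM.trans ((Finset.sum_le_sum fun j hj => hi j hj).trans ?_)
      simp
    rw [hk, hμdef]
    exact_mod_cast h1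
  have hμδ : μ ≤ δ * q := hM i
  -- The members of `E` with a given trace on `W i`.
  set Ey : Finset X → Finset (Finset X) := fun y => E.filter fun e => e ∩ W i = y with hEy
  let P : Finset X → Finset X → Prop := fun y z => ∀ e ∈ Ey y, ¬ e ∩ (W i)ᶜ ⊆ z
  set U := Finset.univ.filter fun x : Finset X => x ∩ W i ∈ M i ∧ P (x ∩ W i) (x \ W i) with hU
  have hcompl : ((W i)ᶜ).card = (K + 1) * N := by
    rw [Finset.card_compl, hX, hWN]
    rw [show K + 2 = (K + 1) + 1 by rfl, Nat.succ_mul, Nat.add_sub_cancel]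
  have hlower : ∑ y ∈ M i, q ^ (K + 1) * (1 / 2 ^ (Ey y).card) ≤ (U.card : ℝ) := by
    rw [hU, card_filter_inter_mem (W i) (M i) hMV P]
    push_cast
    refine Finset.sum_le_sum fun y _ => ?_
    have h1 := le_two_pow_mul_of_card_avoid (W i)ᶜ (Ey y) (by
      intro e he
      obtain ⟨he, -⟩ := Finset.mem_filter.1 he
      obtain ⟨a, ha, hai⟩ := Finset.not_subset.1 (((hEmem e).1 he).2 i)
      exact ⟨a, Finset.mem_inter.2 ⟨ha, Finset.mem_compl.2 hai⟩⟩)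
    rw [hcompl, mul_comm (K + 1) N, pow_mul] at h1
    rw [mul_one_div, div_le_iff₀ (by positivity), mul_comm _ ((2 : ℝ) ^ (Ey y).card)]
    refine h1.trans (mul_le_mul_of_nonneg_left (Nat.cast_le.2 ?_) (by positivity))
    refine le_of_eq (congrArg Finset.card ?_)
    congr
  -- The two exceptional families of sets.
  set U2 := ((Finset.univ.erase i) ×ˢ insert ∅ E).biUnion fun p =>
    Finset.univ.filter fun x : Finset X => x ∩ W i ∈ M i ∧ x ∩ W p.1 = p.2 ∩ W p.1 with hU2
  set U3 := Finset.univ.filter fun x : Finset X => ∃ S ⊆ G, S.card ≤ K + 2 ∧ S.biUnion id = x ∧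
      ∃ e ∈ S, ∃ f ∈ S, e ≠ f ∧ e ∈ E ∧ f ∈ E with hU3
  have hsub : U ⊆ U2 ∪ U3 := by
    intro x hx
    obtain ⟨-, hxM, hxP⟩ := Finset.mem_filter.1 hx
    have hxG := (Finset.mem_sdiff.1 hxM).2
    rw [Finset.mem_insert, not_or] at hxG
    rcases exists_of_inter_notMem hG h0 hW hEmem x i (Finset.nonempty_iff_ne_empty.2 hxG.1)
      hxG.2 with ⟨e, he, hex, hei⟩ | ⟨j, hj, e, he, hej⟩ | h
    · refine absurd ?_ (hxP e (Finset.mem_filter.2 ⟨he, hei⟩))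
      intro a ha
      obtain ⟨ha1, ha2⟩ := Finset.mem_inter.1 ha
      exact Finset.mem_sdiff.2 ⟨hex ha1, Finset.mem_compl.1 ha2⟩
    · refine Finset.mem_union_left _ (Finset.mem_biUnion.2 ⟨(j, e), ?_, ?_⟩)
      · exact Finset.mem_product.2 ⟨Finset.mem_erase.2 ⟨hj, Finset.mem_univ _⟩, he⟩
      · exact Finset.mem_filter.2 ⟨Finset.mem_univ _, hxM, hej⟩
    · exact Finset.mem_union_right _ (Finset.mem_filter.2 ⟨Finset.mem_univ _, h⟩)
  have hU2card : (U2.card : ℝ) ≤ k * (E.card + 1) * (μ * q ^ K) := by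
    have h1 : U2.card ≤ (K + 2) * (E.card + 1) * ((M i).card * 2 ^ (N * K)) := by
      calc U2.card ≤ ((Finset.univ.erase i) ×ˢ insert ∅ E).card * ((M i).card * 2 ^ (N * K)) := by
            refine Finset.card_biUnion_le_card_mul _ _ _ ?_
            intro p hp
            have hp := Finset.ne_of_mem_erase (Finset.mem_product.1 hp).1
            refine (card_inter_mem_inter_eq_le (hW i p.1 hp.symm) hMV _).trans_eq ?_
            rw [hX, hWN, hWN]
            congr 2
            rw [add_mul, mul_comm K N, two_mul, Nat.add_sub_cancel]
        _ ≤ _ := by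
            rw [Finset.card_product]
            gcongr
            · exact (Finset.card_le_univ _).trans_eq (Fintype.card_fin _)
            · exact Finset.card_insert_le _ _
    rw [hk, hμdef, hq, ← pow_mul]
    exact_mod_cast h1
  have hU3card : (U3.card : ℝ) ≤ E.card * E.card * (k * q) ^ K := by
    have h1 : U3.card ≤ E.card * E.card * (G.card + 1) ^ K :=
      card_le_of_two_members U3 fun x hx => (Finset.mem_filter.1 hx).2
    have h2 : U3.card ≤ E.card * E.card * ((K + 2) * 2 ^ N) ^ K :=
      h1.trans (by gcongr; omega)
    rw [hk, hq]
    exact_mod_cast h2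
  have hupper : (U.card : ℝ) ≤ k * (E.card + 1) * (μ * q ^ K) + E.card * E.card * (k * q) ^ K := by
    have h1 : (U.card : ℝ) ≤ U2.card + U3.card := by
      exact_mod_cast (Finset.card_le_card hsub).trans (Finset.card_union_le _ _)
    linarith
  set ψ := k * (k * δ + 1 / q) + k ^ (K + 2) * δ with hψ
  have hupper2 : (U.card : ℝ) ≤ ψ * μ * q ^ (K + 1) := by
    have hEq : (E.card : ℝ) ≤ k * (δ * q) := hEk.trans (by gcongr)
    calc (U.card : ℝ)
        ≤ k * (E.card + 1) * (μ * q ^ K) + E.card * E.card * (k * q) ^ K := hupper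
      _ ≤ k * (k * (δ * q) + 1) * (μ * q ^ K) + (k * μ) * (k * (δ * q)) * (k * q) ^ K := by
          gcongr
      _ = ψ * μ * q ^ (K + 1) := by
          have h1 : 1 / q * q = 1 := one_div_mul_cancel hq0.ne'
          rw [hψ, mul_pow k q K]
          linear_combination (-(k * μ * q ^ K)) * h1
  have hEysum : ∑ y ∈ M i, ((Ey y).card : ℝ) ≤ E.card := by
    have h1 : ∑ y ∈ M i, (Ey y).card ≤ E.card := by
      rw [← Finset.card_biUnion]
      · exact Finset.card_le_card (Finset.biUnion_subset.2 fun y _ => Finset.filter_subset _ _)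
      · intro y _ z _ hyz
        refine Finset.disjoint_left.2 fun e h1 h2 => ?_
        exact hyz ((Finset.mem_filter.1 h1).2.symm.trans (Finset.mem_filter.1 h2).2)
    exact_mod_cast h1
  have hsum : 1 / 4 ^ (K + 2) * (μ / 2) ≤ ∑ y ∈ M i, (1 : ℝ) / 2 ^ (Ey y).card := by
    calc 1 / 4 ^ (K + 2) * (μ / 2)
        ≤ 1 / 4 ^ (K + 2) * (μ - (∑ y ∈ M i, ((Ey y).card : ℝ)) / (2 * k)) := by
          gcongr
          have : (∑ y ∈ M i, ((Ey y).card : ℝ)) / (2 * k) ≤ μ / 2 := by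
            rw [div_le_iff₀ (by positivity)]
            linarith
          linarith
      _ = ∑ y ∈ M i, 1 / 4 ^ (K + 2) * (1 - ((Ey y).card : ℝ) / (2 * ((K + 2 : ℕ) : ℝ))) := by
          rw [← Finset.mul_sum, Finset.sum_sub_distrib, ← Finset.sum_div]
          simp [hμdef, hk]
      _ ≤ _ := Finset.sum_le_sum fun y _ => one_sub_div_le_one_div_two_pow _ _ (by omega)
  have hcontra : q ^ (K + 1) * (1 / 4 ^ (K + 2) * (μ / 2)) ≤ ψ * μ * q ^ (K + 1) := by
    refine le_trans ?_ (hlower.trans hupper2)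
    rw [← Finset.mul_sum]
    gcongr
  have h4 : (0 : ℝ) < 4 ^ (K + 2) := by positivity
  have hfin : 1 / 4 ^ (K + 2) / 2 ≤ ψ := by
    refine le_of_mul_le_mul_right ?_ (mul_pos hμ0 (pow_pos hq0 (K + 1)))
    linarith
  rw [div_div, div_le_iff₀ (by positivity)] at hfin
  linarith

/-! ### Pairwise disjoint tuples and unions of random members -/

/-- The law of the union of `t` independent random sets, each of which has the law `w`. -/
noncomputable def unionPower {X : Type*} [Fintype X] [DecidableEq X] (t : ℕ)
    (w : Finset X → ℝ) (B : Finset X) : ℝ :=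
  ∑ a : Fin t → Finset X, if Finset.univ.biUnion a = B then ∏ i, w (a i) else 0

/-- The probability that independent random sets with the laws `w i` are pairwise disjoint. -/
noncomputable def disjointMass {X : Type*} [Fintype X] [DecidableEq X] {r : ℕ}
    (w : Fin r → Finset X → ℝ) : ℝ :=
  ∑ A ∈ cliques (Disjoint : Finset X → Finset X → Prop) r, ∏ i, w i (A i)

section UnionPower

variable {X : Type*} [Fintype X] [DecidableEq X]

lemma unionPower_nonneg (t : ℕ) {w : Finset X → ℝ} (hw : ∀ A, 0 ≤ w A) (B : Finset X) :
    0 ≤ unionPower t w B := by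
  refine Finset.sum_nonneg fun a _ => ?_
  split_ifs
  · exact Finset.prod_nonneg fun i _ => hw _
  · exact le_rfl

/-- A union is disjoint from `C` when all of its terms are. -/
lemma sum_unionPower_disjoint (t : ℕ) (w : Finset X → ℝ) (C : Finset X) :
    ∑ B ∈ Finset.univ.filter fun B => Disjoint B C, unionPower t w B =
      (∑ A ∈ Finset.univ.filter fun A => Disjoint A C, w A) ^ t := by
  rw [Finset.sum_filter, Finset.sum_filter, Fintype.sum_pow]
  calc ∑ B : Finset X, (if Disjoint B C then unionPower t w B else 0)
      = ∑ B : Finset X, ∑ a : Fin t → Finset X,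
          if Finset.univ.biUnion a = B then
            (if Disjoint B C then ∏ i, w (a i) else 0) else 0 := by
        refine Finset.sum_congr rfl fun B _ => ?_
        by_cases hB : Disjoint B C
        · simp [hB, unionPower]
        · simp [hB]
    _ = ∑ a : Fin t → Finset X,
          if Disjoint (Finset.univ.biUnion a) C then ∏ i, w (a i) else 0 := by
        rw [Finset.sum_comm]
        simp
    _ = _ := by
        refine Finset.sum_congr rfl fun a _ => ?_
        have hd : Disjoint (Finset.univ.biUnion a) C ↔ ∀ i, Disjoint (a i) C := by
          simp [Finset.disjoint_biUnion_left]
        by_cases h : ∀ i, Disjoint (a i) C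
        · rw [if_pos (hd.2 h)]
          simp [h]
        · rw [if_neg (fun h' => h (hd.1 h'))]
          push Not at h
          obtain ⟨i, hi⟩ := h
          exact (Finset.prod_eq_zero (Finset.mem_univ i) (if_neg hi)).symm

lemma sum_unionPower (t : ℕ) {w : Finset X → ℝ} (hw : ∑ A, w A = 1) :
    ∑ B, unionPower t w B = 1 := by
  have := sum_unionPower_disjoint t w ∅
  simpa [hw] using this

lemma unionPower_le (t : ℕ) {w : Finset X → ℝ} (hw : ∀ A, 0 ≤ w A) (B : Finset X) :
    unionPower t w B ≤ (∑ A ∈ B.powerset, w A) ^ t := by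
  have h := sum_unionPower_disjoint t w Bᶜ
  have hp : (Finset.univ.filter fun A => Disjoint A Bᶜ) = B.powerset := by
    ext A
    simp [← Finset.subset_compl_iff_disjoint_right]
  rw [hp] at h
  rw [← h]
  exact Finset.single_le_sum (fun A _ => unionPower_nonneg t hw A)
    (Finset.mem_powerset_self B)

lemma sum_biUnion_le {ι α : Type*} [DecidableEq α] (s : Finset ι) (u : ι → Finset α)
    {f : α → ℝ} (hf : ∀ a, 0 ≤ f a) : ∑ a ∈ s.biUnion u, f a ≤ ∑ i ∈ s, ∑ a ∈ u i, f a := by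
  classical
  induction s using Finset.induction_on with
  | empty => simp
  | insert i s hi ih =>
    rw [Finset.biUnion_insert, Finset.sum_insert hi]
    have h := Finset.sum_union_inter (s₁ := u i) (s₂ := s.biUnion u) (f := f)
    have h0 : 0 ≤ ∑ a ∈ u i ∩ s.biUnion u, f a := Finset.sum_nonneg fun a _ => hf a
    linarith

lemma pow_sum_mul_le {ι : Type*} (s : Finset ι) (c p : ι → ℝ) (hc : ∀ i ∈ s, 0 ≤ c i)
    (hc1 : ∑ i ∈ s, c i ≤ 1) (hp : ∀ i ∈ s, 0 ≤ p i) {t : ℕ} (ht : 1 ≤ t) :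
    (∑ i ∈ s, c i * p i) ^ t ≤ ∑ i ∈ s, c i * p i ^ t := by
  set σ := ∑ i ∈ s, c i with hσ
  have hσ0 : 0 ≤ σ := Finset.sum_nonneg hc
  rcases hσ0.eq_or_lt with h0 | h0
  · have hz := (Finset.sum_eq_zero_iff_of_nonneg hc).1 (hσ.symm.trans h0.symm)
    rw [Finset.sum_eq_zero fun i hi => by rw [hz i hi, zero_mul], zero_pow (by omega)]
    exact Finset.sum_nonneg fun i hi => mul_nonneg (hc i hi) (pow_nonneg (hp i hi) t)
  · have h := Real.pow_arith_mean_le_arith_mean_pow s (fun i => c i / σ) p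
      (fun i hi => div_nonneg (hc i hi) hσ0) (by rw [← Finset.sum_div, ← hσ, div_self h0.ne']) hp t
    have e1 : ∑ i ∈ s, c i * p i = σ * ∑ i ∈ s, c i / σ * p i := by
      rw [Finset.mul_sum]
      refine Finset.sum_congr rfl fun i _ => ?_
      field_simp
    have e2 : ∑ i ∈ s, c i * p i ^ t = σ * ∑ i ∈ s, c i / σ * p i ^ t := by
      rw [Finset.mul_sum]
      refine Finset.sum_congr rfl fun i _ => ?_
      field_simp
    have h2 : 0 ≤ ∑ i ∈ s, c i / σ * p i ^ t := Finset.sum_nonneg fun i hi =>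
      mul_nonneg (div_nonneg (hc i hi) hσ0) (pow_nonneg (hp i hi) t)
    rw [e1, e2, mul_pow]
    calc σ ^ t * (∑ i ∈ s, c i / σ * p i) ^ t ≤ σ ^ t * ∑ i ∈ s, c i / σ * p i ^ t := by gcongr
      _ ≤ σ * ∑ i ∈ s, c i / σ * p i ^ t := by
          gcongr
          exact pow_le_of_le_one hσ0 hc1 (by omega)

lemma disjointMass_succ {j : ℕ} (w : Fin (j + 1) → Finset X → ℝ) (i : Fin (j + 1)) :
    disjointMass w = ∑ S ∈ cliques (Disjoint : Finset X → Finset X → Prop) j,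
      (∏ l, w (i.succAbove l) (S l)) *
        ∑ A ∈ Finset.univ.filter fun A => Disjoint A (Finset.univ.biUnion S), w i A := by
  rw [disjointMass, sum_cliques_succ (fun a b h => h.symm) i]
  refine Finset.sum_congr rfl fun S _ => ?_
  have hN : commonNbrs (Disjoint : Finset X → Finset X → Prop) S =
      Finset.univ.filter fun A => Disjoint A (Finset.univ.biUnion S) := by
    ext A
    simp [mem_commonNbrs, Finset.disjoint_biUnion_right]
  rw [hN, Finset.mul_sum]
  refine Finset.sum_congr rfl fun A _ => ?_
  rw [Fin.prod_univ_succAbove _ i]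
  simp [mul_comm]

/-- Jensen's inequality for the replacement of one of the random sets by a union of `t` independent
copies. -/
lemma pow_disjointMass_le {j : ℕ} (w : Fin (j + 1) → Finset X → ℝ) (hw : ∀ i A, 0 ≤ w i A)
    (hw1 : ∀ i, ∑ A, w i A = 1) (i : Fin (j + 1)) {t : ℕ} (ht : 1 ≤ t) :
    disjointMass w ^ t ≤ disjointMass (Function.update w i (unionPower t (w i))) := by
  rw [disjointMass_succ w i, disjointMass_succ _ i]
  have hc : ∀ S : Fin j → Finset X, 0 ≤ ∏ l, w (i.succAbove l) (S l) := fun S =>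
    Finset.prod_nonneg fun l _ => hw _ _
  refine (pow_sum_mul_le _ _ _ (fun S _ => hc S) ?_
    (fun S _ => Finset.sum_nonneg fun A _ => hw i A) ht).trans_eq ?_
  · calc ∑ S ∈ cliques (Disjoint : Finset X → Finset X → Prop) j, ∏ l, w (i.succAbove l) (S l)
        ≤ ∑ S : Fin j → Finset X, ∏ l, w (i.succAbove l) (S l) :=
          Finset.sum_le_sum_of_subset_of_nonneg (Finset.subset_univ _) fun S _ _ => hc S
      _ = ∏ l, ∑ A, w (i.succAbove l) A := by
          rw [Finset.prod_univ_sum, Fintype.piFinset_univ]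
      _ = 1 := Finset.prod_eq_one fun l _ => hw1 _
      _ ≤ 1 := le_rfl
  · refine Finset.sum_congr rfl fun S _ => ?_
    simp [sum_unionPower_disjoint]

/-- The replacement of all the random sets by unions, one after another. -/
lemma pow_disjointMass_le_unionPower {r : ℕ} {w : Finset X → ℝ} (hw : ∀ A, 0 ≤ w A)
    (hw1 : ∑ A, w A = 1) {t : ℕ} (ht : 1 ≤ t) :
    disjointMass (fun _ : Fin r => w) ^ t ^ r ≤
      disjointMass (fun _ : Fin r => unionPower t w) := by
  classical
  have key : ∀ S : Finset (Fin r), disjointMass (fun _ : Fin r => w) ^ t ^ S.card ≤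
      disjointMass (fun i : Fin r => if i ∈ S then unionPower t w else w) := by
    intro S
    induction S using Finset.induction_on with
    | empty => simp
    | insert i S hi ih =>
      obtain ⟨j, rfl⟩ : ∃ j, r = j + 1 := ⟨r - 1, by have := i.2; omega⟩
      have h0 : 0 ≤ disjointMass (fun _ : Fin (j + 1) => w) :=
        Finset.sum_nonneg fun A _ => Finset.prod_nonneg fun _ _ => hw _
      have h := pow_disjointMass_le
        (fun i : Fin (j + 1) => if i ∈ S then unionPower t w else w)
        (fun l A => by
          split_ifs
          · exact unionPower_nonneg t hw A
          · exact hw A)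
        (fun l => by
          split_ifs
          · exact sum_unionPower t hw1
          · exact hw1) i ht
      rw [Finset.card_insert_of_notMem hi, pow_succ, pow_mul]
      refine (pow_le_pow_left₀ (pow_nonneg h0 _) ih t).trans (h.trans_eq ?_)
      congr 1
      funext l
      by_cases hl : l = i
      · subst hl
        simp [hi]
      · simp [hl]
  simpa using key Finset.univ

/-- Of `k + 1` disjoint sets one has at most `k * N / (k + 1)` elements, which is unlikely for a
union of `(k + 1) ^ 2` random sets. -/
lemma disjointMass_unionPower_le {k N : ℕ} (hX : Fintype.card X = k * N) {w : Finset X → ℝ}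
    (hw : ∀ A, 0 ≤ w A) (hw1 : ∑ A, w A = 1) (hwq : ∀ A, w A ≤ 1 / 2 ^ N) :
    disjointMass (fun _ : Fin (k + 1) => unionPower ((k + 1) ^ 2) w) ≤ (k + 1) / 2 ^ N := by
  classical
  set t := (k + 1) ^ 2 with ht
  set u := unionPower t w with hu
  have hu0 : ∀ A, 0 ≤ u A := unionPower_nonneg t hw
  have hu1 : ∑ A, u A = 1 := sum_unionPower t hw1
  set small : Finset (Finset X) := Finset.univ.filter fun B => (k + 1) * B.card ≤ k * N with hsm
  have hsmall : ∀ B ∈ small, u B ≤ 1 / (2 ^ (k * N) * 2 ^ N) := by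
    intro B hB
    have hB := (Finset.mem_filter.1 hB).2
    refine (unionPower_le t hw B).trans ?_
    have h1 : ∑ A ∈ B.powerset, w A ≤ 2 ^ B.card * (1 / 2 ^ N) := by
      refine (Finset.sum_le_sum fun A _ => hwq A).trans_eq ?_
      simp
    have h2 : B.card * t + (k * N + N) ≤ N * t := by
      have : (k + 1) * ((k + 1) * B.card) ≤ (k + 1) * (k * N) := Nat.mul_le_mul_left _ hB
      rw [ht]
      nlinarith
    calc (∑ A ∈ B.powerset, w A) ^ t ≤ (2 ^ B.card * (1 / 2 ^ N)) ^ t := by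
          gcongr
          exact Finset.sum_nonneg fun A _ => hw A
      _ = 2 ^ (B.card * t) / 2 ^ (N * t) := by
          rw [mul_one_div, div_pow, pow_mul, pow_mul]
      _ ≤ 1 / (2 ^ (k * N) * 2 ^ N) := by
          rw [div_le_div_iff₀ (by positivity) (by positivity), one_mul, ← pow_add, ← pow_add]
          exact pow_le_pow_right₀ (by norm_num) h2
  have hsum : ∑ B ∈ small, u B ≤ 1 / 2 ^ N := by
    calc ∑ B ∈ small, u B ≤ ∑ B ∈ small, (1 / (2 ^ (k * N) * 2 ^ N) : ℝ) :=
          Finset.sum_le_sum hsmall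
      _ = (small.card : ℝ) * (1 / (2 ^ (k * N) * 2 ^ N)) := by simp
      _ ≤ 2 ^ (k * N) * (1 / (2 ^ (k * N) * 2 ^ N)) := by
          gcongr
          have h := Finset.card_le_univ small
          rw [Fintype.card_finset, hX] at h
          exact_mod_cast h
      _ = 1 / 2 ^ N := by
          have : (0 : ℝ) < 2 ^ (k * N) := by positivity
          field_simp
  -- One of `k + 1` disjoint sets is small.
  have hsub : cliques (Disjoint : Finset X → Finset X → Prop) (k + 1) ⊆
      Finset.univ.biUnion fun i : Fin (k + 1) =>
        Fintype.piFinset fun l => if l = i then small else Finset.univ := by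
    intro A hA
    have hex : ∃ i, (k + 1) * (A i).card ≤ k * N := by
      by_contra! hlt
      have h1 : ∑ i, (A i).card ≤ k * N := by
        rw [← hX, ← Finset.card_biUnion (fun i _ l _ hil => mem_cliques.1 hA i l hil)]
        exact Finset.card_le_univ _
      have h2 : ∑ i : Fin (k + 1), k * N < ∑ i, (k + 1) * (A i).card :=
        Finset.sum_lt_sum_of_nonempty Finset.univ_nonempty fun i _ => hlt i
      rw [Finset.sum_const, Finset.card_univ, Fintype.card_fin, smul_eq_mul,
        ← Finset.mul_sum] at h2
      exact absurd (Nat.mul_le_mul_left (k + 1) h1) (not_le.2 h2)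
    obtain ⟨i, hi⟩ := hex
    refine Finset.mem_biUnion.2 ⟨i, Finset.mem_univ _, Fintype.mem_piFinset.2 fun l => ?_⟩
    by_cases hl : l = i
    · subst hl
      simpa [hsm] using hi
    · simp [hl]
  have hpr : ∀ A : Fin (k + 1) → Finset X, 0 ≤ ∏ i, u (A i) := fun A =>
    Finset.prod_nonneg fun i _ => hu0 _
  calc disjointMass (fun _ : Fin (k + 1) => u)
      ≤ ∑ A ∈ Finset.univ.biUnion fun i : Fin (k + 1) =>
          Fintype.piFinset fun l => if l = i then small else Finset.univ, ∏ i, u (A i) :=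
        Finset.sum_le_sum_of_subset_of_nonneg hsub fun A _ _ => hpr A
    _ ≤ ∑ i : Fin (k + 1), ∑ A ∈ Fintype.piFinset
          fun l : Fin (k + 1) => if l = i then small else Finset.univ, ∏ i, u (A i) :=
        sum_biUnion_le _ _ hpr
    _ = ∑ i : Fin (k + 1), ∑ B ∈ small, u B := by
        refine Finset.sum_congr rfl fun i _ => ?_
        rw [← Finset.prod_univ_sum, Finset.prod_eq_single i]
        · simp
        · intro l _ hl
          simp [hl, hu1]
        · simp
    _ ≤ ∑ i : Fin (k + 1), (1 / 2 ^ N : ℝ) := Finset.sum_le_sum fun i _ => hsum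
    _ = (k + 1) / 2 ^ N := by
        simp [div_eq_mul_inv]

/-- Pairwise disjoint `(k + 1)`-tuples are rare in a family of at least `2 ^ N` subsets of a set of
size `k * N`. The unions of `(k + 1) ^ 2` random members nearly always have more than
`k * N / (k + 1)` elements, and so `k + 1` such unions are hardly ever disjoint. -/
lemma card_cliques_disjoint_le {k N : ℕ} (hX : Fintype.card X = k * N) (H : Finset (Finset X))
    (hH : 2 ^ N ≤ H.card) :
    (((cliques (fun A B : H => Disjoint A.1 B.1) (k + 1)).card : ℝ) / H.card ^ (k + 1)) ^
      ((k + 1) ^ 2) ^ (k + 1) ≤ (k + 1) / 2 ^ N := by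
  classical
  have hHq : (2 : ℝ) ^ N ≤ H.card := by exact_mod_cast hH
  have hH0 : (0 : ℝ) < H.card := lt_of_lt_of_le (by positivity) hHq
  set w : Finset X → ℝ := fun A => if A ∈ H then 1 / (H.card : ℝ) else 0 with hw
  have hw0 : ∀ A, 0 ≤ w A := by
    intro A
    simp only [hw]
    split_ifs <;> positivity
  have hw1 : ∑ A, w A = 1 := by
    simp [hw, hH0.ne']
  have hwq : ∀ A, w A ≤ 1 / 2 ^ N := by
    intro A
    simp only [hw]
    split_ifs
    · gcongr
    · positivity
  have hle : ((cliques (fun A B : H => Disjoint A.1 B.1) (k + 1)).card : ℝ) / H.card ^ (k + 1) ≤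
      disjointMass (fun _ : Fin (k + 1) => w) := by
    have hinj : Function.Injective fun (A : Fin (k + 1) → H) i => (A i).1 := by
      intro A B hAB
      funext i
      exact Subtype.ext (congrFun hAB i)
    have hprod : ∀ A : Fin (k + 1) → H, ∏ i, w (A i).1 = 1 / (H.card : ℝ) ^ (k + 1) := by
      intro A
      have : ∀ i, w (A i).1 = 1 / (H.card : ℝ) := fun i => if_pos (A i).2
      simp [this]
    calc ((cliques (fun A B : H => Disjoint A.1 B.1) (k + 1)).card : ℝ) / H.card ^ (k + 1)
        = ∑ A ∈ cliques (fun A B : H => Disjoint A.1 B.1) (k + 1), ∏ i, w (A i).1 := by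
          simp_rw [hprod]
          rw [Finset.sum_const, nsmul_eq_mul, mul_one_div]
      _ = ∑ A ∈ (cliques (fun A B : H => Disjoint A.1 B.1) (k + 1)).image
            fun A i => (A i).1, ∏ i, w (A i) := by
          rw [Finset.sum_image fun A _ B _ h => hinj h]
      _ ≤ disjointMass (fun _ : Fin (k + 1) => w) := by
          refine Finset.sum_le_sum_of_subset_of_nonneg ?_
            fun A _ _ => Finset.prod_nonneg fun i _ => hw0 _
          intro A hA
          obtain ⟨B, hB, rfl⟩ := Finset.mem_image.1 hA
          exact mem_cliques.2
            (mem_cliques (r := fun A B : H => Disjoint A.1 B.1).1 hB)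
  calc _ ≤ disjointMass (fun _ : Fin (k + 1) => w) ^ ((k + 1) ^ 2) ^ (k + 1) := by
        gcongr
    _ ≤ disjointMass (fun _ : Fin (k + 1) => unionPower ((k + 1) ^ 2) w) :=
        pow_disjointMass_le_unionPower hw0 hw1 (Nat.one_le_pow _ _ (by omega))
    _ ≤ _ := disjointMass_unionPower_le hX hw0 hw1 hwq

end UnionPower

/-! ### The disjointness graph of a small generator -/

section Generator

variable {X : Type*} [Fintype X] [DecidableEq X]

/-- Every set is the union of a `k`-tuple of members, some of which may be empty. -/
lemma two_pow_le_card_of_isKGenerator {k N : ℕ} (hk : 1 ≤ k) (hX : Fintype.card X = k * N)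
    {G : Finset (Finset X)} (hG : IsKGenerator k G) : 2 ^ N ≤ (insert ∅ G).card := by
  have hsub : (Finset.univ : Finset (Finset X)) ⊆
      (Fintype.piFinset fun _ : Fin k => insert ∅ G).image fun g => Finset.univ.biUnion g := by
    intro x _
    obtain ⟨S, hSG, hSk, -, hSx⟩ := hG x
    obtain ⟨g, hg, hgS⟩ := exists_tuple_biUnion_eq S hSk
    exact Finset.mem_image.2 ⟨g, Fintype.mem_piFinset.2 fun i =>
      Finset.insert_subset_insert ∅ hSG (hg i), hgS.trans hSx⟩
  have h := (Finset.card_le_card hsub).trans Finset.card_image_le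
  rw [Finset.card_univ, Fintype.card_finset, hX, Fintype.card_piFinset, Finset.prod_const,
    Finset.card_univ, Fintype.card_fin, mul_comm, pow_mul] at h
  exact (Nat.pow_le_pow_iff_left (by omega)).1 h

/-- Apart from few sets which are unions of at most `K` members, each set gives rise to
`(K + 1)!` ordered cliques in the disjointness graph of a `(K + 1)`-generator. -/
lemma factorial_mul_le_card_cliques {K : ℕ} {G : Finset (Finset X)}
    (hG : IsKGenerator (K + 1) G) :
    (K + 1).factorial * 2 ^ Fintype.card X ≤
      (cliques (fun A B : (insert ∅ G : Finset (Finset X)) => Disjoint A.1 B.1) (K + 1)).card +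
        (K + 1).factorial * (insert ∅ G).card ^ K := by
  classical
  set H := insert ∅ G with hH
  set good : Finset (Finset X) := Finset.univ.filter fun x =>
    ∃ v : Fin (K + 1) → H, Function.Injective v ∧
      v ∈ cliques (fun A B : H => Disjoint A.1 B.1) (K + 1) ∧
      (Finset.univ.biUnion fun i => (v i).1) = x with hgood
  have hbad : goodᶜ.card ≤ H.card ^ K := by
    have hsub : goodᶜ ⊆
        (Fintype.piFinset fun _ : Fin K => H).image fun g => Finset.univ.biUnion g := by
      intro x hx
      obtain ⟨S, hSG, hSk, hSd, hSx⟩ := hG x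
      rcases hSk.lt_or_eq with hlt | heq
      · obtain ⟨g, hg, hgS⟩ := exists_tuple_biUnion_eq S (Nat.lt_succ_iff.1 hlt)
        exact Finset.mem_image.2 ⟨g, Fintype.mem_piFinset.2 fun i =>
          Finset.insert_subset_insert ∅ hSG (hg i), hgS.trans hSx⟩
      · refine absurd (Finset.mem_filter.2 ⟨Finset.mem_univ _, ?_⟩) (Finset.mem_compl.1 hx)
        let e := S.equivFinOfCardEq heq
        refine ⟨fun i => ⟨(e.symm i).1, Finset.mem_insert_of_mem (hSG (e.symm i).2)⟩, ?_, ?_, ?_⟩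
        · intro i j hij
          exact e.symm.injective (Subtype.ext (congrArg (fun z : H => z.1) hij))
        · refine mem_cliques.2 fun i j hij => hSd _ (e.symm i).2 _ (e.symm j).2 ?_
          exact fun h => hij (e.symm.injective (Subtype.ext h))
        · rw [← hSx]
          ext a
          simp only [Finset.mem_biUnion, Finset.mem_univ, true_and, id]
          constructor
          · rintro ⟨i, hi⟩
            exact ⟨_, (e.symm i).2, hi⟩
          · rintro ⟨s, hs, ha⟩
            exact ⟨e ⟨s, hs⟩, by simpa using ha⟩
    refine (Finset.card_le_card hsub).trans (Finset.card_image_le.trans_eq ?_)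
    rw [Fintype.card_piFinset, Finset.prod_const, Finset.card_univ, Fintype.card_fin]
  have hgoodcard : good.card * (K + 1).factorial ≤
      (cliques (fun A B : H => Disjoint A.1 B.1) (K + 1)).card := by
    have hex : ∀ x : Finset X, ∃ v : Fin (K + 1) → H, x ∈ good → Function.Injective v ∧
        v ∈ cliques (fun A B : H => Disjoint A.1 B.1) (K + 1) ∧
        (Finset.univ.biUnion fun i => (v i).1) = x := by
      intro x
      by_cases hx : x ∈ good
      · obtain ⟨v, hv⟩ := (Finset.mem_filter.1 hx).2
        exact ⟨v, fun _ => hv⟩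
      · exact ⟨fun _ => ⟨∅, Finset.mem_insert_self _ _⟩, fun h => absurd h hx⟩
    choose v hv using hex
    have hperm : (K + 1).factorial = (Finset.univ : Finset (Equiv.Perm (Fin (K + 1)))).card := by
      rw [Finset.card_univ, Fintype.card_perm, Fintype.card_fin]
    rw [hperm, ← Finset.card_product]
    refine Finset.card_le_card_of_injOn (fun p => v p.1 ∘ p.2) ?_ ?_
    · rintro ⟨x, σ⟩ hp
      have hx := (Finset.mem_product.1 hp).1
      refine mem_cliques.2 fun i j hij => ?_
      exact mem_cliques.1 (hv x hx).2.1 (σ i) (σ j) (fun h => hij (σ.injective h))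
    · rintro ⟨x, σ⟩ hp ⟨y, τ⟩ hp' h
      have hx := (Finset.mem_product.1 hp).1
      have hy := (Finset.mem_product.1 hp').1
      have hun : ∀ z ∈ good, ∀ ρ : Equiv.Perm (Fin (K + 1)),
          (Finset.univ.biUnion fun i => ((v z ∘ ρ) i).1) = z := by
        intro z hz ρ
        conv_rhs => rw [← (hv z hz).2.2]
        ext a
        simp only [Finset.mem_biUnion, Finset.mem_univ, true_and, Function.comp_apply]
        exact ρ.surjective.exists (p := fun i => a ∈ (v z i).1) |>.symm
      have hxy : x = y := by
        rw [← hun x hx σ, ← hun y hy τ]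
        exact congrArg (fun w : Fin (K + 1) → H => Finset.univ.biUnion fun i => (w i).1) h
      subst hxy
      refine Prod.ext rfl (Equiv.ext fun i => ?_)
      exact (hv x hx).1 (congrFun h i)
  have hcompl : good.card + goodᶜ.card = 2 ^ Fintype.card X := by
    rw [Finset.card_add_card_compl, Fintype.card_finset]
  calc (K + 1).factorial * 2 ^ Fintype.card X
      = good.card * (K + 1).factorial + (K + 1).factorial * goodᶜ.card := by rw [← hcompl]; ring
    _ ≤ _ := by gcongr

/-- A small generator contains almost all subsets of each class of a partition into equal
classes. -/
lemma exists_partition_of_isKGenerator {K N : ℕ} (hX : Fintype.card X = (K + 1) * N)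
    {G : Finset (Finset X)} (hG : IsKGenerator (K + 1) G)
    (hcard : G.card + (K + 1) ≤ (K + 1) * 2 ^ N) {η β ε γ : ℝ} (hη : 0 ≤ η) (hη2 : η ≤ 1 / 2)
    (hη3 : ((K + 1 : ℕ) + 1 : ℝ) / 2 ^ N ≤ η ^ ((K + 1 + 1) ^ 2) ^ (K + 1 + 1))
    (hη4 : (K + 1 : ℝ) ^ K ≤ η * 2 ^ N)
    (hε : ε = η + (K + 1) ^ (K + 3) * (2 * (1 + 2 * (K + 1) ^ (K + 3) * (K + 2)) * η))
    (hε2 : ε ≤ 1 / 2) (hβ : 0 ≤ β) (hεβ : 2 * ε ≤ β ^ 2)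
    (hγ : γ = ε + (K + 1) * ((K + 1) * N * β)) (hγ1 : (2 * (K + 1) + 1) * γ < 1) :
    ∃ W : Fin (K + 1) → Finset X, (∀ i j, i ≠ j → Disjoint (W i) (W j)) ∧
      (∀ i, (W i).card = N) ∧
      ∀ i, (((W i).powerset \ insert ∅ G).card : ℝ) ≤ 2 * γ * 2 ^ N := by
  classical
  set H := insert ∅ G with hH
  set q : ℝ := 2 ^ N with hq
  have hq0 : 0 < q := by positivity
  set r : H → H → Prop := fun A B => Disjoint A.1 B.1 with hr
  have hsymm : ∀ A B, r A B → r B A := fun A B h => h.symm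
  have hVH : (Fintype.card H : ℝ) = H.card := by rw [Fintype.card_coe]
  have hHq : 2 ^ N ≤ H.card := two_pow_le_card_of_isKGenerator (by omega) hX hG
  have hH0 : (0 : ℝ) < H.card := Nat.cast_pos.2 (lt_of_lt_of_le (by positivity) hHq)
  have hHle : (H.card : ℝ) ≤ (K + 1) * q := by
    have h1 : H.card ≤ (K + 1) * 2 ^ N := (Finset.card_insert_le _ _).trans (by omega)
    rw [hq]
    exact_mod_cast h1
  have hbig : ((cliques r (K + 2)).card : ℝ) ≤ η * (Fintype.card H : ℝ) ^ (K + 2) := by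
    rw [hVH, ← div_le_iff₀ (by positivity)]
    refine le_of_pow_le_pow_left₀ (n := ((K + 1 + 1) ^ 2) ^ (K + 1 + 1)) (by positivity) hη ?_
    exact (card_cliques_disjoint_le hX H hHq).trans hη3
  have hmany : (1 - η) * ((K + 1).factorial * q ^ (K + 1)) ≤ ((cliques r (K + 1)).card : ℝ) := by
    have h1 : ((K + 1).factorial : ℝ) * 2 ^ Fintype.card X ≤
        (cliques r (K + 1)).card + (K + 1).factorial * (H.card : ℝ) ^ K := by
      exact_mod_cast factorial_mul_le_card_cliques hG
    rw [hX, mul_comm (K + 1) N, pow_mul, ← hq] at h1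
    have h2 : (H.card : ℝ) ^ K ≤ η * q ^ (K + 1) := by
      calc (H.card : ℝ) ^ K ≤ ((K + 1) * q) ^ K := by gcongr
        _ = (K + 1) ^ K * q ^ K := mul_pow _ _ _
        _ ≤ η * q * q ^ K := by gcongr
        _ = η * q ^ (K + 1) := by ring
    have h3 : ((K + 1).factorial : ℝ) * (H.card : ℝ) ^ K ≤
        (K + 1).factorial * (η * q ^ (K + 1)) := by gcongr
    linarith
  obtain ⟨c, hc⟩ := exists_coloring_of_card_cliques hsymm K hη hη2 hq0 (hVH ▸ hHle) hmany hbig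
  have hHle' : (Fintype.card H : ℝ) ≤ ((K + 1 : ℕ) : ℝ) * q := by
    rw [hVH]
    push_cast
    exact hHle
  have htr := le_card_transversalCliques c (by positivity) hHle' hc hmany hq0.le
  obtain ⟨hprod, hpairs⟩ := card_unrelated_le c hq0 hε2 hHle' (by
    refine le_trans (le_of_eq ?_) htr
    rw [hε]
    push_cast
    ring)
  set s : Fin (K + 1) → Finset H := fun i => Finset.univ.filter fun v => c v = i with hs
  have hval : Function.Injective (Subtype.val : H → Finset X) := Subtype.val_injective
  let C : Fin (K + 1) → Finset (Finset X) := fun i => (s i).map ⟨Subtype.val, hval⟩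
  have hC : ∀ i, (C i).card = (s i).card := fun i => Finset.card_map _
  have hCH : ∀ i, C i ⊆ H := by
    intro i A hA
    obtain ⟨B, -, rfl⟩ := Finset.mem_map.1 hA
    exact B.2
  have hε0 : 0 ≤ ε := by rw [hε]; positivity
  obtain ⟨W, hW1, hW2, hW3⟩ := exists_partition_of_families (γ := γ) hX C hβ hε0 hεβ
    (by rw [hγ, hX]; push_cast; ring) (by push_cast; exact hγ1)
    (by simp_rw [hC]; exact hprod)
    (by
      simp_rw [hC]
      refine le_trans (le_of_eq ?_) hHle'
      rw [← Finset.card_univ, Finset.card_eq_sum_card_fiberwise (f := c) (t := Finset.univ)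
        (fun _ _ => Finset.mem_coe.2 (Finset.mem_univ _))]
      push_cast
      rfl)
    (by
      intro i j hij
      rw [hC, hC]
      refine le_trans (Nat.cast_le.2 ?_) (hpairs i j hij)
      refine Finset.card_le_card_of_surjOn (fun p => (p.1.1, p.2.1)) ?_
      rintro ⟨A, B⟩ hAB
      obtain ⟨h1, h2⟩ := Finset.mem_filter.1 hAB
      obtain ⟨h3, h4⟩ := Finset.mem_product.1 h1
      obtain ⟨a, ha, rfl⟩ := Finset.mem_map.1 h3
      obtain ⟨b, hb, rfl⟩ := Finset.mem_map.1 h4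
      exact ⟨(a, b), Finset.mem_filter.2 ⟨Finset.mem_product.2 ⟨ha, hb⟩, h2⟩, rfl⟩)
  refine ⟨W, hW1, hW2, fun i => le_trans (Nat.cast_le.2 (Finset.card_le_card ?_)) (hW3 i)⟩
  exact Finset.sdiff_subset_sdiff (Finset.Subset.refl _) (hCH i)

end Generator

/-! ### Generators of minimum size -/

lemma eventually_pow_le_mul_two_pow (p : ℕ) {a : ℝ} (ha : 0 < a) :
    ∀ᶠ N : ℕ in Filter.atTop, (N : ℝ) ^ p ≤ a * 2 ^ N := by
  have h := tendsto_pow_const_div_const_pow_of_one_lt p (show (1 : ℝ) < 2 by norm_num)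
  filter_upwards [h.eventually (gt_mem_nhds ha)] with N hN
  rw [div_lt_iff₀ (by positivity)] at hN
  exact hN.le

/-- Parameters with which the estimates for `k = K + 2` hold: `γ` is a constant, a small enough
proportion of missing sets, and `η` is of the order of `N ^ (-2)`. -/
lemma exists_parameters (K : ℕ) {k : ℝ} (hk2 : 2 ≤ k) : ∃ N₀ : ℕ, ∀ N : ℕ, N₀ ≤ N →
    ∃ η β ε γ : ℝ, 0 ≤ η ∧ η ≤ 1 / 2 ∧ (k + 1) / 2 ^ N ≤ η ^ ((K + 3) ^ 2) ^ (K + 3) ∧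
      k ^ (K + 1) ≤ η * 2 ^ N ∧
      ε = η + k ^ (K + 4) * (2 * (1 + 2 * k ^ (K + 4) * (k + 1)) * η) ∧ ε ≤ 1 / 2 ∧ 0 ≤ β ∧
      2 * ε ≤ β ^ 2 ∧ γ = ε + k * (k * N * β) ∧ (2 * k + 1) * γ < 1 ∧
      2 * 4 ^ (K + 2) * (k * (k * (2 * γ) + 1 / 2 ^ N) + k ^ (K + 2) * (2 * γ)) < 1 := by
  have hk0 : 0 < k := by linarith
  -- The value of `γ` is at most `1 / D`, which `β = b / N` and `ε = β ^ 2 / 2` achieve.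
  obtain ⟨L, hL, hL0⟩ : ∃ L : ℝ, L = 4 ^ (K + 2) * (k ^ 2 + k ^ (K + 2)) ∧ 0 < L :=
    ⟨_, rfl, by positivity⟩
  obtain ⟨D, hD⟩ : ∃ D : ℝ, D = 16 * L + (2 * k + 2) := ⟨_, rfl⟩
  have hD1 : 1 ≤ D := by linarith
  have hD0 : 0 < D := by linarith
  obtain ⟨C, hC, hC1⟩ :
      ∃ C : ℝ, C = 1 + k ^ (K + 4) * (2 * (1 + 2 * k ^ (K + 4) * (k + 1))) ∧ 1 ≤ C :=
    ⟨_, rfl, le_add_of_nonneg_right (by positivity)⟩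
  have hC0 : 0 < C := by linarith
  obtain ⟨b, hb⟩ : ∃ b : ℝ, b = 1 / (D * (1 + k ^ 2)) := ⟨_, rfl⟩
  have hb0 : 0 < b := by rw [hb]; positivity
  have hbD : b * (1 + k ^ 2) * D = 1 := by rw [hb]; field_simp
  have hb1 : b ≤ 1 := by
    rw [hb, div_le_one (by positivity)]
    exact one_le_mul_of_one_le_of_one_le hD1 (by linarith [sq_nonneg k])
  obtain ⟨a, ha⟩ : ∃ a : ℝ, a = b ^ 2 / (2 * C) := ⟨_, rfl⟩
  have ha0 : 0 < a := by rw [ha]; positivity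
  obtain ⟨d, hd⟩ : ∃ d : ℕ, d = ((K + 3) ^ 2) ^ (K + 3) := ⟨_, rfl⟩
  rw [← hd]
  obtain ⟨N₀, hN₀⟩ := Filter.eventually_atTop.1
    ((eventually_pow_le_mul_two_pow (2 * d) (show 0 < a ^ d / (k + 1) by positivity)).and
      ((eventually_pow_le_mul_two_pow 2 (show 0 < a / k ^ (K + 1) by positivity)).and
        (eventually_pow_le_mul_two_pow 0 (show 0 < 1 / (8 * 4 ^ (K + 2) * k) by positivity))))
  refine ⟨max 1 N₀, fun N hN => ?_⟩
  obtain ⟨hA, hB, hE⟩ := hN₀ N ((le_max_right _ _).trans hN)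
  have hN1 : (1 : ℝ) ≤ N := by exact_mod_cast (le_max_left _ _).trans hN
  have hN0 : (0 : ℝ) < N := by linarith
  obtain ⟨q, hq, hq0⟩ : ∃ q : ℝ, q = 2 ^ N ∧ 0 < q := ⟨_, rfl, by positivity⟩
  rw [← hq] at hA hB hE ⊢
  obtain ⟨η, hη⟩ : ∃ η : ℝ, η = a / N ^ 2 := ⟨_, rfl⟩
  obtain ⟨β, hβ⟩ : ∃ β : ℝ, β = b / N := ⟨_, rfl⟩
  obtain ⟨ε, hε⟩ : ∃ ε : ℝ, ε = C * η := ⟨_, rfl⟩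
  obtain ⟨γ, hγ⟩ : ∃ γ : ℝ, γ = ε + k * (k * N * β) := ⟨_, rfl⟩
  have hη0 : 0 ≤ η := by rw [hη]; positivity
  have hεβ : 2 * ε = β ^ 2 := by
    rw [hε, hη, ha, hβ]
    field_simp
  have hβb : β ≤ b := hβ ▸ div_le_self hb0.le hN1
  have hβ0 : 0 ≤ β := by rw [hβ]; positivity
  have hεb : 2 * ε ≤ b := by
    rw [hεβ, sq]
    exact (mul_le_of_le_one_left hβ0 (hβb.trans hb1)).trans hβb
  have hηε : η ≤ ε := by
    rw [hε]
    exact le_mul_of_one_le_left hη0 hC1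
  have hε0 : 0 ≤ ε := hη0.trans hηε
  have hγ0 : 0 ≤ γ := by rw [hγ]; positivity
  have hγD : γ * D ≤ 1 := by
    have h1 : k * (k * N * β) = k ^ 2 * b := by
      rw [hβ]
      field_simp
    rw [← hbD]
    gcongr
    rw [hγ, h1]
    linarith
  have hγL : 16 * (L * γ) + (2 * k + 2) * γ ≤ 1 := by
    rw [hD] at hγD
    linarith
  have hLγ : 0 ≤ L * γ := by positivity
  have hkγ : 0 ≤ k * γ := by positivity
  refine ⟨η, β, ε, γ, hη0, by linarith, ?_, ?_, ?_, by linarith, hβ0, hεβ.le, hγ, ?_, ?_⟩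
  · rw [hη, div_pow, ← pow_mul, div_le_div_iff₀ hq0 (by positivity)]
    rw [div_mul_eq_mul_div, le_div_iff₀ (by positivity)] at hA
    linarith
  · rw [hη, div_mul_eq_mul_div, le_div_iff₀ (by positivity)]
    rw [div_mul_eq_mul_div, le_div_iff₀ (by positivity)] at hB
    linarith
  · rw [hε, hC]
    ring
  · rcases hγ0.eq_or_lt with h | h
    · rw [← h]
      norm_num
    · linarith
  · have hE' : 2 * 4 ^ (K + 2) * (k * (1 / q)) ≤ 1 / 4 := by
      rw [pow_zero, one_div_mul_eq_div, le_div_iff₀ (by positivity), one_mul] at hE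
      rw [mul_one_div, ← mul_div_assoc, div_le_iff₀ hq0]
      linarith
    have h8 : 2 * 4 ^ (K + 2) * (k * (k * (2 * γ) + 1 / q) + k ^ (K + 2) * (2 * γ)) =
        2 * 4 ^ (K + 2) * (k * (1 / q)) + 4 * (L * γ) := by
      rw [hL]
      ring
    rw [h8]
    linarith

/-- A generator not larger than the canonical families consists of the nonempty subsets of the
classes of a partition into equal classes. -/
lemma exists_classes_of_isKGenerator (K : ℕ) : ∃ N₀ : ℕ, ∀ N : ℕ, N₀ ≤ N →
    ∀ (X : Type*) [Fintype X] [DecidableEq X], Fintype.card X = (K + 2) * N →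
      ∀ G : Finset (Finset X), IsKGenerator (K + 2) G → ∅ ∉ G →
        G.card + (K + 2) ≤ (K + 2) * 2 ^ N →
        ∃ W : Fin (K + 2) → Finset X, (∀ i j, i ≠ j → Disjoint (W i) (W j)) ∧
          (∀ i, (W i).card = N) ∧ ∀ A, A ∈ G ↔ A ≠ ∅ ∧ ∃ i, A ⊆ W i := by
  obtain ⟨N₀, hN₀⟩ := exists_parameters K (k := (K : ℝ) + 2)
    (le_add_of_nonneg_left (Nat.cast_nonneg _))
  refine ⟨N₀, fun N hN X _ _ hX G hG h0 hcard => ?_⟩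
  obtain ⟨η, β, ε, γ, hη0, hη2, hη3, hη4, hε, hε2, hβ0, hεβ, hγ, hγ1, hδ⟩ := hN₀ N hN
  have hkk : ((K + 1 : ℕ) : ℝ) + 1 = K + 2 := by push_cast; ring
  have hkk1 : ((K + 1 + 1 : ℕ) : ℝ) = K + 2 := by push_cast; ring
  have hkk2 : ((K + 1 : ℕ) : ℝ) + 2 = K + 2 + 1 := by push_cast; ring
  obtain ⟨W, hW1, hW2, hW3⟩ := exists_partition_of_isKGenerator (K := K + 1) (γ := γ) hX hG hcard
    hη0 hη2 (by rw [hkk1]; exact hη3) (by rw [hkk]; exact hη4) (by rw [hkk, hkk2]; exact hε) hε2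
    hβ0 hεβ (by rw [hkk]; exact hγ) (by rw [hkk]; exact hγ1)
  exact ⟨W, hW1, hW2, mem_iff_of_few_missing hX hG h0 hcard hW1 hW2 hW3 hδ⟩

/-- For `k = 1` every nonempty set is a member of the generator. -/
lemma mem_of_isKGenerator_one {X : Type*} [DecidableEq X] {G : Finset (Finset X)}
    (hG : IsKGenerator 1 G) {A : Finset X} (hA : A ≠ ∅) : A ∈ G := by
  obtain ⟨S, hSG, hSk, -, hSx⟩ := hG A
  rcases Nat.le_one_iff_eq_zero_or_eq_one.1 hSk with h | h
  · rw [Finset.card_eq_zero.1 h] at hSx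
    exact absurd hSx.symm hA
  · obtain ⟨B, rfl⟩ := Finset.card_eq_one.1 h
    have : B = A := by simpa using hSx
    exact this ▸ hSG (Finset.mem_singleton_self B)

section Canonical

variable {X : Type*} [Fintype X] [DecidableEq X]

lemma mem_powersetFamily {P : Finpartition (Finset.univ : Finset X)} {A : Finset X} :
    A ∈ powersetFamily P ↔ A ≠ ∅ ∧ ∃ p ∈ P.parts, A ⊆ p := by
  simp [powersetFamily, and_comm]

/-- Equal classes which are disjoint and large enough to cover the ground set form an
equipartition. -/
lemma isCanonical_of_classes {k N : ℕ} (hN : 1 ≤ N) (hX : Fintype.card X = k * N)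
    {W : Fin k → Finset X} (hW : ∀ i j, i ≠ j → Disjoint (W i) (W j))
    (hWN : ∀ i, (W i).card = N) {G : Finset (Finset X)}
    (hG : ∀ A, A ∈ G ↔ A ≠ ∅ ∧ ∃ i, A ⊆ W i) : IsCanonical k G := by
  have hne : ∀ i, W i ≠ ∅ := fun i h => by
    have := hWN i
    rw [h, Finset.card_empty] at this
    omega
  have hinj : Function.Injective W := by
    intro i j hij
    by_contra h
    have := hW i j h
    rw [hij, Finset.disjoint_self_iff_empty] at this
    exact hne j this
  let P : Finpartition (Finset.univ : Finset X) :=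
    { parts := Finset.univ.image W
      supIndep := by
        rw [Finset.supIndep_iff_pairwiseDisjoint]
        intro A hA B hB hAB
        obtain ⟨i, -, rfl⟩ := Finset.mem_image.1 hA
        obtain ⟨j, -, rfl⟩ := Finset.mem_image.1 hB
        exact hW i j fun h => hAB (congrArg W h)
      sup_parts := by
        rw [Finset.sup_image, ← Finset.card_eq_iff_eq_univ, Function.id_comp,
          Finset.sup_eq_biUnion, Finset.card_biUnion fun i _ j _ hij => hW i j hij, hX]
        simp [hWN]
      bot_notMem := by
        intro h
        obtain ⟨i, -, hi⟩ := Finset.mem_image.1 h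
        exact hne i hi }
  refine ⟨P, ?_, ?_, ?_⟩
  · refine Set.equitableOn_iff_exists_eq_eq_add_one.2 ⟨N, fun A hA => Or.inl ?_⟩
    obtain ⟨i, -, rfl⟩ := Finset.mem_image.1 hA
    exact hWN i
  · change (Finset.univ.image W).card = k
    rw [Finset.card_image_of_injective _ hinj, Finset.card_univ, Fintype.card_fin]
  · ext A
    rw [hG, mem_powersetFamily]
    simp [P]

lemma card_part_of_isEquipartition {k N : ℕ} (hX : Fintype.card X = k * N) (hk : 1 ≤ k)
    {P : Finpartition (Finset.univ : Finset X)} (hP : P.IsEquipartition)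
    (hPk : P.parts.card = k) {p : Finset X} (hp : p ∈ P.parts) : p.card = N := by
  have hav : (Finset.univ : Finset X).card / P.parts.card = N := by
    rw [Finset.card_univ, hX, hPk, Nat.mul_div_cancel_left _ (by omega)]
  have hge : ∀ p ∈ P.parts, N ≤ p.card := fun p hp => hav ▸ hP.average_le_card_part hp
  have hsum : ∑ p ∈ P.parts, p.card = ∑ _p ∈ P.parts, N := by
    rw [P.sum_card_parts, Finset.card_univ, hX, Finset.sum_const, hPk, smul_eq_mul]
  exact ((Finset.sum_eq_sum_iff_of_le hge).1 hsum.symm p hp).symm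

lemma isKGenerator_powersetFamily (P : Finpartition (Finset.univ : Finset X)) :
    IsKGenerator P.parts.card (powersetFamily P) := by
  intro x
  refine ⟨(P.parts.image fun p => x ∩ p).erase ∅, ?_, ?_, ?_, ?_⟩
  · intro A hA
    obtain ⟨hA0, hA⟩ := Finset.mem_erase.1 hA
    obtain ⟨p, hp, rfl⟩ := Finset.mem_image.1 hA
    exact mem_powersetFamily.2 ⟨hA0, p, hp, Finset.inter_subset_right⟩
  · exact (Finset.card_le_card (Finset.erase_subset _ _)).trans Finset.card_image_le
  · intro A hA B hB hAB
    obtain ⟨p, hp, rfl⟩ := Finset.mem_image.1 (Finset.mem_of_mem_erase hA)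
    obtain ⟨p', hp', rfl⟩ := Finset.mem_image.1 (Finset.mem_of_mem_erase hB)
    have hne : p ≠ p' := fun h => hAB (by rw [h])
    exact (P.disjoint hp hp' hne).mono Finset.inter_subset_right Finset.inter_subset_right
  · ext a
    simp only [Finset.mem_biUnion, Finset.mem_erase, Finset.mem_image, id]
    constructor
    · rintro ⟨_, ⟨-, p, -, rfl⟩, ha⟩
      exact (Finset.mem_inter.1 ha).1
    · intro ha
      obtain ⟨p, hp, hap⟩ := P.exists_mem (Finset.mem_univ a)
      have hm := Finset.mem_inter.2 ⟨ha, hap⟩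
      exact ⟨x ∩ p, ⟨Finset.ne_empty_of_mem hm, p, hp, rfl⟩, hm⟩

lemma card_powersetFamily_add {k N : ℕ} {P : Finpartition (Finset.univ : Finset X)}
    (hPk : P.parts.card = k) (hPN : ∀ p ∈ P.parts, p.card = N) :
    (powersetFamily P).card + k = k * 2 ^ N := by
  have heq : powersetFamily P = P.parts.biUnion fun p => p.powerset.erase ∅ := by
    ext A
    rw [mem_powersetFamily]
    simp only [Finset.mem_biUnion, Finset.mem_erase, Finset.mem_powerset]
    tauto
  have hcard : (powersetFamily P).card = k * (2 ^ N - 1) := by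
    rw [heq, Finset.card_biUnion]
    · rw [Finset.sum_const_nat (m := 2 ^ N - 1), hPk]
      intro p hp
      rw [Finset.card_erase_of_mem (Finset.empty_mem_powerset p), Finset.card_powerset, hPN p hp]
    · intro p hp p' hp' hne
      refine Finset.disjoint_left.2 fun A hA hA' => ?_
      obtain ⟨h1, h2⟩ := Finset.mem_erase.1 hA
      have h3 := (Finset.mem_erase.1 hA').2
      exact h1 ((Finset.disjoint_self_iff_empty _).1 ((P.disjoint hp hp' hne).mono
        (Finset.mem_powerset.1 h2) (Finset.mem_powerset.1 h3)))
  have : 1 ≤ 2 ^ N := Nat.one_le_two_pow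
  rw [hcard, Nat.mul_sub, mul_one, Nat.sub_add_cancel (Nat.le_mul_of_pos_right k this)]

lemma IsKGenerator.erase_empty {X : Type*} [DecidableEq X] {k : ℕ} {G : Finset (Finset X)}
    (hG : IsKGenerator k G) :
    IsKGenerator k (G.erase ∅) := by
  intro x
  obtain ⟨S, hSG, hSk, hSd, hSx⟩ := hG x
  refine ⟨S.erase ∅, Finset.erase_subset_erase _ hSG,
    (Finset.card_le_card (Finset.erase_subset _ _)).trans hSk, ?_, ?_⟩
  · intro a ha b hb hab
    exact hSd a (Finset.mem_of_mem_erase ha) b (Finset.mem_of_mem_erase hb) hab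
  · rw [← hSx]
    ext a
    simp only [Finset.mem_biUnion, Finset.mem_erase, id]
    constructor
    · rintro ⟨s, ⟨-, hs⟩, ha⟩
      exact ⟨s, hs, ha⟩
    · rintro ⟨s, hs, ha⟩
      exact ⟨s, ⟨Finset.ne_empty_of_mem ha, hs⟩, ha⟩

end Canonical

/-- A generator without the empty set which is not larger than the canonical families is
canonical. -/
lemma isCanonical_of_card_le (k : ℕ) (hk : 1 ≤ k) : ∃ N₀ : ℕ, ∀ N : ℕ, N₀ ≤ N →
    ∀ (X : Type*) [Fintype X] [DecidableEq X], Fintype.card X = k * N →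
      ∀ G : Finset (Finset X), IsKGenerator k G → ∅ ∉ G → G.card + k ≤ k * 2 ^ N →
        IsCanonical k G := by
  rcases hk.eq_or_lt with rfl | hk
  · refine ⟨1, fun N hN X _ _ hX G hG h0 _ => ?_⟩
    refine isCanonical_of_classes hN hX (W := fun _ => Finset.univ)
      (fun i j hij => absurd (Subsingleton.elim i j) hij) (fun _ => by simpa using hX) ?_
    intro A
    refine ⟨fun hA => ⟨fun h => h0 (h ▸ hA), 0, Finset.subset_univ A⟩, fun hA => ?_⟩
    exact mem_of_isKGenerator_one hG hA.1
  · obtain ⟨K, rfl⟩ := Nat.exists_eq_add_of_le' hk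
    obtain ⟨N₀, hN₀⟩ := exists_classes_of_isKGenerator K
    refine ⟨max 1 N₀, fun N hN X _ _ hX G hG h0 hcard => ?_⟩
    obtain ⟨W, hW1, hW2, hW3⟩ := hN₀ N ((le_max_right _ _).trans hN) X hX G hG h0 hcard
    exact isCanonical_of_classes ((le_max_left _ _).trans hN) hX hW1 hW2 hW3

theorem mainTheorem2 (k : ℕ) (hk : 1 ≤ k) :
    ∃ n₀ : ℕ, ∀ n : ℕ, n₀ ≤ n → k ∣ n →
      ∀ (X : Type*) [Fintype X] [DecidableEq X], Fintype.card X = n →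
        (∃ F : Finset (Finset X), IsCanonical k F) ∧
        (∀ F : Finset (Finset X), IsCanonical k F →
          IsKGenerator k F ∧ (F.card : ℤ) = k * 2 ^ (n / k) - k) ∧
        ∀ G : Finset (Finset X), IsKGenerator k G →
          ∀ F : Finset (Finset X), IsCanonical k F →
            F.card ≤ G.card ∧ (G.card = F.card → IsCanonical k G) := by
  obtain ⟨N₀, hN₀⟩ := isCanonical_of_card_le k hk
  refine ⟨k * max 1 N₀, ?_⟩
  rintro _ hn ⟨N, rfl⟩ X _ _ hX
  have hN : max 1 N₀ ≤ N := Nat.le_of_mul_le_mul_left hn hk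
  have hcard : ∀ F : Finset (Finset X), IsCanonical k F → F.card + k = k * 2 ^ N := by
    rintro F ⟨P, hP, hPk, rfl⟩
    exact card_powersetFamily_add hPk fun p hp => card_part_of_isEquipartition hX hk hP hPk hp
  -- Removing the empty set from a generator no larger than `F` leaves a canonical family, which is
  -- as large as `F`.
  have hmin : ∀ G : Finset (Finset X), IsKGenerator k G → G.card + k ≤ k * 2 ^ N →
      G.card + k = k * 2 ^ N ∧ IsCanonical k G := by
    intro G hG hle
    have hle' : (G.erase ∅).card ≤ G.card := Finset.card_le_card (Finset.erase_subset _ _)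
    have hcan := hN₀ N ((le_max_right _ _).trans hN) X hX (G.erase ∅) hG.erase_empty
      (Finset.notMem_erase _ _) (by omega)
    have hc := hcard _ hcan
    have heq : G.erase ∅ = G :=
      Finset.eq_of_subset_of_card_le (Finset.erase_subset _ _) (by omega)
    rw [heq] at hcan hc
    exact ⟨hc, hcan⟩
  refine ⟨?_, ?_, ?_⟩
  · obtain ⟨P, hP, hPk⟩ := Finpartition.exists_equipartition_card_eq (Finset.univ : Finset X)
      (n := k) (by omega) (by
        rw [Finset.card_univ, hX]
        exact Nat.le_mul_of_pos_right k ((le_max_left _ _).trans hN))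
    exact ⟨powersetFamily P, P, hP, hPk, rfl⟩
  · intro F hF
    have hc := hcard F hF
    refine ⟨?_, ?_⟩
    · obtain ⟨P, -, hPk, rfl⟩ := hF
      exact hPk ▸ isKGenerator_powersetFamily P
    · rw [Nat.mul_div_cancel_left _ hk, eq_sub_iff_add_eq]
      exact_mod_cast hc
  · intro G hG F hF
    have hc := hcard F hF
    refine ⟨?_, fun h => (hmin G hG (by omega)).2⟩
    by_contra! hlt
    have := (hmin G hG (by omega)).1
    omega
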